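/- Let $T\ge 0$, $n,m\in\mathbb N$. A continuous-time hidden Markov model $(Q,r,\pi_0)$ on $[0,T]$ is a pair of processes $X_t\in\{1,\dots,n\}$, $Y_t\in\{1,\dots,m\}$, $t\in[0,T]$, on a probability space, such that: (i) $X$ is a time-homogeneous Markov process whose paths are right-continuous step functions with finitely many jumps, with $\Pr\{X_0=i\}=\pi_0(i)$ and generator $Q\in\mathbb R^{n\times n}$, i.e. $Q_{ij}=\lim_{h\downarrow0}\Pr\{X_{t+h}=j\mid X_t=i\}/h$ for $i\ne j$, and $Q_{ii}=-\sum_{j\ne i}Q_{ij}$; (ii) if $0=\tilde\tau_0<\tilde\tau_1<\dots<\tilde\tau_{\tilde S}\le T$ are time $0$ and the jump times of $X$, then, conditionally on the path of $X$, the values $Y_{\tilde\tau_0},\dots,Y_{\tilde\tau_{\tilde S}}$ are independent, $Y_{\tilde\tau_s}$ having the probability distribution $r_i(\cdot)$ on $\{1,\dots,m\}$ where $i=X_{\tilde\tau_s}$, and $Y$ is constant on each $[\tilde\tau_s,\tilde\tau_{s+1})$, $s<\tilde S$, and on $[\tilde\tau_{\tilde S},T]$. Put $D=\operatorname{diag}(Q_{11},\dots,Q_{nn})$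 and $R(y)=\operatorname{diag}(r_1(y),\dots,r_n(y))$. For a right-continuous step function $y:[0,T]\to\{1,\dots,m\}$ let $0=\tau_0$ and let $\tau_1<\dots<\tau_S\le T$ be its discontinuities; let $I_s=[\tau_s,\tau_{s+1})$ for $s<S$ and $I_S=[\tau_S,T]$. Consider the forward equation for a row vector $\alpha_t\in\mathbb R^{1\times n}$, $$\alpha_0=\pi_0R(y_0),\qquad \dot\alpha_t=\alpha_t\,[D+(Q-D)R(y_{\tau_s})]\ \ (t\in I_s,\ 0\le s\le S),\qquad \alpha_{\tau_s}=\alpha_{\tau_s^-}(Q-D)R(y_{\tau_s})\ \ (1\le s\le S),$$ and the backward equation for a column vector $\beta_t\in\mathbb R^{n\times1}$, $$\beta_T=(1,\dots,1)^{\intercal},\qquad \dot\beta_t=-[D+(Q-D)R(y_{\tau_s})]\,\beta_t\ \ (t\in I_s,\ 0\le s\le S),\qquad \beta_{\tau_s^-}=(Q-D)R(y_{\tau_s})\beta_{\tau_s}\ \ (1\le s\le S),$$ where $\dot{}$ denotes the derivative relative to $I_s$, and $\alpha_{\tau_s^-}$, $\beta_{\tau_s^-}$ are left limits. Then, for a continuous-time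 hidden Markov model $(Q,r,\pi_0)$: 1. Every path of $Y$ is a right-continuous step function. For every right-continuous step function $y$, each of the two equations has exactly one solution on $[0,T]$, and $\alpha_t\cdot\beta_t=\sum_{i=1}^n\alpha_t(i)\beta_t(i)$ does not depend on $t\in[0,T]$. 2. If $\alpha,\beta$ denote the solutions along the observed path $y=Y$, then almost surely $\alpha_0\cdot\beta_0>0$, and for every $t\in[0,T]$ and $i\in\{1,\dots,n\}$, almost surely $$\Pr\{X_t=i\mid Y_s,\ s\in[0,T]\}=\frac{\alpha_t(i)\,\beta_t(i)}{\alpha_0\cdot\beta_0}.$$ -/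

import Mathlib

open MeasureTheory ProbabilityTheory Filter Topology Set

noncomputable section

namespace CTHMM

/-- The `s`-th piece of the partition `τ 0 < ... < τ S` of `[0, T]`: it is `[τ s, τ (s+1))` for
`s < S`, and the last piece `[τ S, T]` contains the endpoint `T`. -/
def piece (T : ℝ) (S : ℕ) (τ : ℕ → ℝ) (s : ℕ) : Set ℝ :=
  if s < S then Ico (τ s) (τ (s + 1)) else Icc (τ s) T

/-- The path `y` is constant on each piece of the partition. -/
def ConstOnPieces {E : Type*} (T : ℝ) (y : ℝ → E) (S : ℕ) (τ : ℕ → ℝ) : Prop :=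
  ∀ s ≤ S, ∀ t ∈ piece T S τ s, y t = y (τ s)

/-- On `[0, T]` the path `y` is a right-continuous step function whose successive discontinuities
are exactly `τ 1 < ... < τ S` (and `τ 0 = 0`). The values `τ s` with `s > S` play no role. -/
structure IsJumpPartition {E : Type*} (T : ℝ) (y : ℝ → E) (S : ℕ) (τ : ℕ → ℝ) : Prop where
  zero : τ 0 = 0
  lt : ∀ s < S, τ s < τ (s + 1)
  le : τ S ≤ T
  const : ConstOnPieces T y S τ
  ne : ∀ s < S, y (τ (s + 1)) ≠ y (τ s)

/-- The σ-algebra generated by `Z u`, `u ∈ [0, t]`. -/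
abbrev pathSigma {Ω E : Type*} (Z : ℝ → Ω → E) (t : ℝ) : MeasurableSpace Ω :=
  ⨆ u ∈ Icc (0 : ℝ) t, MeasurableSpace.comap (Z u) ⊤

variable {Ω : Type*} [MeasurableSpace Ω] {n m : ℕ}

/-- `X` is, on `[0, T]`, a (time-homogeneous, Markov) jump process with values in `Fin n`, initial
distribution `π₀` and generator `Q`. -/
structure IsJumpProcess (μ : Measure Ω) (T : ℝ) (Q : Matrix (Fin n) (Fin n) ℝ)
    (π₀ : Fin n → ℝ) (X : ℝ → Ω → Fin n) : Prop where
  measurable : ∀ t ∈ Icc 0 T, Measurable (X t)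
  /-- every path is a right-continuous step function with finitely many jumps -/
  path : ∀ ω, ∃ S τ, IsJumpPartition T (fun t => X t ω) S τ
  init : ∀ i, μ.real {ω | X 0 ω = i} = π₀ i
  /-- The Markov property with transition probabilities
  `P h i j = Pr{X (t + h) = j | X t = i}`, and `Q i j = lim P h i j / h` for `h ↓ 0`, `i ≠ j`. -/
  markov : ∃ P : ℝ → Matrix (Fin n) (Fin n) ℝ,
    (∀ h, 0 ≤ h → P h ∈ Matrix.rowStochastic ℝ (Fin n)) ∧
    (∀ s t, 0 ≤ s → s ≤ t → t ≤ T → ∀ A, MeasurableSet[pathSigma X s] A → ∀ i j,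
      μ.real (A ∩ {ω | X s ω = i} ∩ {ω | X t ω = j}) =
        μ.real (A ∩ {ω | X s ω = i}) * P (t - s) i j) ∧
    ∀ i j, i ≠ j → Tendsto (fun h => P h i j / h) (𝓝[>] 0) (𝓝 (Q i j))
  diag : ∀ i, Q i i = -∑ j ∈ Finset.univ.erase i, Q i j

/-- `(X, Y)` is, on `[0, T]`, a continuous-time hidden Markov model `(Q, r, π₀)`. -/
structure IsCTHMM (μ : Measure Ω) (T : ℝ) (Q : Matrix (Fin n) (Fin n) ℝ)
    (r : Fin n → Fin m → ℝ) (π₀ : Fin n → ℝ) (X : ℝ → Ω → Fin n) (Y : ℝ → Ω → Fin m) :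
    Prop where
  hidden : IsJumpProcess μ T Q π₀ X
  emission : ∀ i, r i ∈ stdSimplex ℝ (Fin m)
  measurable : ∀ t ∈ Icc 0 T, Measurable (Y t)
  /-- between successive jump times of the hidden path the observation is held constant -/
  held : ∀ ω S τ, IsJumpPartition T (fun t => X t ω) S τ →
    ConstOnPieces T (fun t => Y t ω) S τ
  /-- Given the whole hidden path, the observations at time `0` and at the hidden jump times are
  independent, the one drawn when the hidden state is `i` having distribution `r i`. -/
  observe : ∀ A, MeasurableSet[pathSigma X T] A →
    ∀ (S : ℕ) (x : ℕ → Fin n) (y : ℕ → Fin m),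
      μ.real (A ∩ {ω | ∃ τ, IsJumpPartition T (fun t => X t ω) S τ ∧
          ∀ s ≤ S, X (τ s) ω = x s ∧ Y (τ s) ω = y s}) =
        μ.real (A ∩ {ω | ∃ τ, IsJumpPartition T (fun t => X t ω) S τ ∧
          ∀ s ≤ S, X (τ s) ω = x s}) * ∏ s ∈ Finset.range (S + 1), r (x s) (y s)

/-- `D = diag(Q₁₁, ..., Qₙₙ)`. -/
def D (Q : Matrix (Fin n) (Fin n) ℝ) : Matrix (Fin n) (Fin n) ℝ :=
  Matrix.diagonal fun i => Q i i

/-- `R(y) = diag(r₁(y), ..., rₙ(y))`. -/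
def R (r : Fin n → Fin m → ℝ) (y : Fin m) : Matrix (Fin n) (Fin n) ℝ :=
  Matrix.diagonal fun i => r i y

open scoped Matrix

/-- The forward piecewise ODE on `[0, T]` along the step path `y` with discontinuities
`τ 1, ..., τ S`. -/
structure IsForwardSolution (T : ℝ) (Q : Matrix (Fin n) (Fin n) ℝ) (r : Fin n → Fin m → ℝ)
    (π₀ : Fin n → ℝ) (y : ℝ → Fin m) (S : ℕ) (τ : ℕ → ℝ) (α : ℝ → Fin n → ℝ) : Prop where
  init : α 0 = π₀ ᵥ* R r (y 0)
  ode : ∀ s ≤ S, ∀ t ∈ piece T S τ s,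
    HasDerivWithinAt α (α t ᵥ* (D Q + (Q - D Q) * R r (y (τ s)))) (piece T S τ s) t
  jump : ∀ s, 1 ≤ s → s ≤ S → ∃ a : Fin n → ℝ,
    Tendsto α (𝓝[<] (τ s)) (𝓝 a) ∧ α (τ s) = a ᵥ* ((Q - D Q) * R r (y (τ s)))

/-- The backward piecewise ODE on `[0, T]` along the step path `y` with discontinuities
`τ 1, ..., τ S`. -/
structure IsBackwardSolution (T : ℝ) (Q : Matrix (Fin n) (Fin n) ℝ) (r : Fin n → Fin m → ℝ)
    (y : ℝ → Fin m) (S : ℕ) (τ : ℕ → ℝ) (β : ℝ → Fin n → ℝ) : Prop where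
  final : β T = fun _ => 1
  ode : ∀ s ≤ S, ∀ t ∈ piece T S τ s,
    HasDerivWithinAt β (-((D Q + (Q - D Q) * R r (y (τ s))) *ᵥ β t)) (piece T S τ s) t
  jump : ∀ s, 1 ≤ s → s ≤ S →
    Tendsto β (𝓝[<] (τ s)) (𝓝 (((Q - D Q) * R r (y (τ s))) *ᵥ β (τ s)))

end CTHMM

end

open CTHMM MeasureTheory ProbabilityTheory Set
open scoped Matrix

/-! Observe the model only on the grid of mesh `T / K`. Unless the hidden path jumps twice within
one cell, an event whose probability tends to `0` as `K → ∞`, the observation is redrawn exactly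
when the hidden grid values change; up to that event the grid values therefore follow a
discrete-time model whose likelihood and posterior are products of one-step matrices along the
observations. A step during which the observation `y` stays put is
`1 + (T / K) (D + (Q - D) R(y)) + o(1 / K)`, and one with a change to `y` is
`(T / K) ((Q - D) R(y) + o(1))`. After division by a power of the mesh, one factor for each
observed change, these products converge along every step path to the flow of the forward and
backward equations, so that the discrete posterior converges to `α_t(i) β_t(i) / (α_0 ⬝ β_0)`.

The quotient makes sense almost surely: grid observations whose likelihood is below `ε` times
mesh raised to the number of changes have total likelihood at most
`ε ∑_y (T / K) ^ changes y = ε m (1 + (m - 1) T / K) ^ K`, which stays of order `ε`.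
-/

namespace CTHMM

open Filter Topology NormedSpace Asymptotics
open scoped Matrix.Norms.Operator

noncomputable section

section Exponential

variable {𝔸 : Type*} [NormedRing 𝔸]

theorem norm_one_add_pow_le (E : 𝔸) (j : ℕ) : ‖(1 + E) ^ j‖ ≤ ‖(1 : 𝔸)‖ * (1 + ‖E‖) ^ j := by
  induction j with
  | zero => simp
  | succ j ih =>
    calc ‖(1 + E) ^ (j + 1)‖ = ‖(1 + E) ^ j + (1 + E) ^ j * E‖ := by rw [pow_succ, mul_one_add]
      _ ≤ ‖(1 + E) ^ j‖ + ‖(1 + E) ^ j‖ * ‖E‖ := norm_add_le_of_le le_rfl (norm_mul_le _ _)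
      _ = ‖(1 + E) ^ j‖ * (1 + ‖E‖) := by ring
      _ ≤ ‖(1 : 𝔸)‖ * (1 + ‖E‖) ^ j * (1 + ‖E‖) := by gcongr
      _ = ‖(1 : 𝔸)‖ * (1 + ‖E‖) ^ (j + 1) := by ring

theorem norm_one_add_pow_sub_one_add_pow_le {E F : 𝔸} {e : ℝ} (hE : ‖E‖ ≤ e) (hF : ‖F‖ ≤ e)
    (j : ℕ) :
    ‖(1 + E) ^ j - (1 + F) ^ j‖ ≤ j * (‖(1 : 𝔸)‖ * ‖E - F‖) * (1 + e) ^ j := by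
  induction j with
  | zero => simp
  | succ j ih =>
    have he : 1 ≤ 1 + e := by linarith [norm_nonneg E]
    have hsplit : (1 + E) ^ (j + 1) - (1 + F) ^ (j + 1) =
        (1 + E) ^ j * (E - F) +
          (((1 + E) ^ j - (1 + F) ^ j) + ((1 + E) ^ j - (1 + F) ^ j) * F) := by
      rw [pow_succ, pow_succ]; noncomm_ring
    have hpow : ‖(1 + E) ^ j‖ ≤ ‖(1 : 𝔸)‖ * (1 + e) ^ j :=
      (norm_one_add_pow_le E j).trans (by gcongr)
    calc ‖(1 + E) ^ (j + 1) - (1 + F) ^ (j + 1)‖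
        ≤ ‖(1 + E) ^ j‖ * ‖E - F‖ + (‖(1 + E) ^ j - (1 + F) ^ j‖ +
            ‖(1 + E) ^ j - (1 + F) ^ j‖ * ‖F‖) := by
          rw [hsplit]
          exact norm_add_le_of_le (norm_mul_le _ _) (norm_add_le_of_le le_rfl (norm_mul_le _ _))
      _ ≤ ‖(1 : 𝔸)‖ * (1 + e) ^ j * ‖E - F‖ + (j * (‖(1 : 𝔸)‖ * ‖E - F‖) * (1 + e) ^ j +
            j * (‖(1 : 𝔸)‖ * ‖E - F‖) * (1 + e) ^ j * e) := by gcongr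
      _ ≤ ‖(1 : 𝔸)‖ * (1 + e) ^ (j + 1) * ‖E - F‖ + (j * (‖(1 : 𝔸)‖ * ‖E - F‖) * (1 + e) ^ j +
            j * (‖(1 : 𝔸)‖ * ‖E - F‖) * (1 + e) ^ j * e) := by gcongr; omega
      _ = (j + 1 : ℕ) * (‖(1 : 𝔸)‖ * ‖E - F‖) * (1 + e) ^ (j + 1) := by push_cast; ring

theorem tendsto_one_add_pow_sub_one_add_pow {E F : ℕ → 𝔸} {d : ℕ → ℝ} {j : ℕ → ℕ} {c t : ℝ}
    (hE : ∀ᶠ K in atTop, ‖E K‖ ≤ c * d K) (hF : ∀ᶠ K in atTop, ‖F K‖ ≤ c * d K)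
    (hEF : (fun K => E K - F K) =o[atTop] d) (hj : Tendsto (fun K => j K * d K) atTop (𝓝 t)) :
    Tendsto (fun K => (1 + E K) ^ j K - (1 + F K) ^ j K) atTop (𝓝 0) := by
  have hprod : Tendsto (fun K => j K * (‖(1 : 𝔸)‖ * ‖E K - F K‖)) atTop (𝓝 0) := by
    have hbig : (fun K => (j K : ℝ) * d K) =O[atTop] fun _ => (1 : ℝ) := hj.isBigO_one ℝ
    have hsmall : (fun K => (j K : ℝ) * ‖E K - F K‖) =o[atTop] fun K => (j K : ℝ) * d K :=
      (isBigO_refl _ _).mul_isLittleO hEF.norm_left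
    have h := ((isLittleO_one_iff ℝ).1 (hsmall.trans_isBigO hbig)).const_mul ‖(1 : 𝔸)‖
    rw [mul_zero] at h
    exact h.congr fun K => by ring
  have hexp : Tendsto (fun K => Real.exp (c * (j K * d K))) atTop (𝓝 (Real.exp (c * t))) :=
    (Real.continuous_exp.tendsto _).comp (hj.const_mul c)
  refine squeeze_zero_norm' ?_ (by simpa using hprod.mul hexp)
  filter_upwards [hE, hF] with K hEK hFK
  have hcd : 0 ≤ c * d K := (norm_nonneg _).trans hEK
  refine (norm_one_add_pow_sub_one_add_pow_le hEK hFK (j K)).trans ?_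
  gcongr
  calc (1 + c * d K) ^ j K ≤ Real.exp (c * d K) ^ j K := by
        gcongr; linarith [Real.add_one_le_exp (c * d K)]
    _ = Real.exp (c * (j K * d K)) := by rw [← Real.exp_nat_mul]; ring_nf

variable [NormedAlgebra ℝ 𝔸] [CompleteSpace 𝔸]

theorem exp_sub_smul_mul_exp_sub_smul (A : 𝔸) (a b c : ℝ) :
    exp ((b - a) • A) * exp ((c - b) • A) = exp ((c - a) • A) := by
  let _ : NormedAlgebra ℚ 𝔸 := .restrictScalars ℚ ℝ 𝔸
  rw [← exp_add_of_commute (((Commute.refl A).smul_left _).smul_right _), ← add_smul]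
  congr 2
  ring

theorem hasDerivAt_exp_sub_const_smul (A : 𝔸) (a t : ℝ) :
    HasDerivAt (fun t : ℝ => exp ((t - a) • A)) (exp ((t - a) • A) * A) t := by
  have h := (hasDerivAt_exp_smul_const (𝕂 := ℝ) A (t - a)).scomp t ((hasDerivAt_id t).sub_const a)
  rwa [one_smul] at h

theorem exp_smul_sub_one_sub_smul_isLittleO (A : 𝔸) :
    (fun t : ℝ => exp (t • A) - 1 - t • A) =o[𝓝 0] fun t => t := by
  simpa using (hasDerivAt_exp_smul_const (𝕂 := ℝ) A 0).isLittleO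

theorem tendsto_pow_exp_smul (A : 𝔸) {B : ℕ → 𝔸} {d : ℕ → ℝ} {j : ℕ → ℕ} {t : ℝ}
    (hd : Tendsto d atTop (𝓝 0)) (hd0 : ∀ K, 0 ≤ d K)
    (hB : (fun K => B K - 1 - d K • A) =o[atTop] d)
    (hj : Tendsto (fun K => j K * d K) atTop (𝓝 t)) :
    Tendsto (fun K => B K ^ j K) atTop (𝓝 (exp (t • A))) := by
  let _ : NormedAlgebra ℚ 𝔸 := .restrictScalars ℚ ℝ 𝔸
  have hexp : (fun K => exp (d K • A) - 1 - d K • A) =o[atTop] d :=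
    (exp_smul_sub_one_sub_smul_isLittleO A).comp_tendsto hd
  have hnorm : ∀ {G : ℕ → 𝔸}, (fun K => G K - 1 - d K • A) =o[atTop] d →
      ∀ᶠ K in atTop, ‖G K - 1‖ ≤ (1 + ‖A‖) * d K := fun {G} hG => by
    filter_upwards [hG.bound one_pos] with K hK
    calc ‖G K - 1‖ ≤ ‖G K - 1 - d K • A‖ + ‖d K • A‖ := norm_le_norm_sub_add _ _
      _ ≤ 1 * ‖d K‖ + ‖d K‖ * ‖A‖ := add_le_add hK (norm_smul_le _ _)
      _ = (1 + ‖A‖) * d K := by rw [Real.norm_of_nonneg (hd0 K)]; ring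
  have hdiff := tendsto_one_add_pow_sub_one_add_pow (hnorm hB) (hnorm hexp)
    ((hB.sub hexp).congr_left fun K => by abel) hj
  have hpow : Tendsto (fun K => exp (d K • A) ^ j K) atTop (𝓝 (exp (t • A))) := by
    refine (((exp_continuous (𝔸 := 𝔸)).tendsto _).comp (hj.smul_const A)).congr fun K => ?_
    rw [← exp_nsmul, ← Nat.cast_smul_eq_nsmul ℝ, smul_smul]; rfl
  simpa using hdiff.add hpow

end Exponential

section LinearODE

variable {ι : Type*} [Fintype ι] {s : Set ℝ} {t : ℝ}

theorem hasDerivWithinAt_vecMul {u : ℝ → ι → ℝ} {u' : ι → ℝ} {M : ℝ → Matrix ι ι ℝ}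
    {M' : Matrix ι ι ℝ} (hu : HasDerivWithinAt u u' s t) (hM : HasDerivWithinAt M M' s t) :
    HasDerivWithinAt (fun t => u t ᵥ* M t) (u' ᵥ* M t + u t ᵥ* M') s t := by
  have hentry : ∀ i j, HasDerivWithinAt (fun t => M t i j) (M' i j) s t := fun i j =>
    (Matrix.entryLinearMap ℝ ℝ i j).toContinuousLinearMap.hasFDerivAt.comp_hasDerivWithinAt t hM
  refine hasDerivWithinAt_pi.2 fun j => ?_
  refine (HasDerivWithinAt.fun_sum (u := Finset.univ) fun i _ =>
    (hasDerivWithinAt_pi.1 hu i).mul (hentry i j)).congr_deriv ?_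
  simp [Matrix.vecMul, dotProduct, Finset.sum_add_distrib]

variable [DecidableEq ι] (A : Matrix ι ι ℝ)

theorem hasDerivAt_vecMul_exp (v : ι → ℝ) (a t : ℝ) :
    HasDerivAt (fun t : ℝ => v ᵥ* exp ((t - a) • A)) ((v ᵥ* exp ((t - a) • A)) ᵥ* A) t := by
  rw [← hasDerivWithinAt_univ]
  refine (hasDerivWithinAt_vecMul (hasDerivWithinAt_const t univ v)
    (hasDerivAt_exp_sub_const_smul A a t).hasDerivWithinAt).congr_deriv ?_
  rw [Matrix.zero_vecMul, zero_add]
  exact (Matrix.vecMul_vecMul ..).symm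

theorem exp_mulVec_eq_vecMul_exp_neg_transpose (w : ι → ℝ) (b t : ℝ) :
    exp ((b - t) • A) *ᵥ w = w ᵥ* exp ((t - b) • (-Aᵀ)) := by
  rw [smul_neg, ← neg_smul, neg_sub, ← Matrix.transpose_smul, Matrix.exp_transpose,
    Matrix.vecMul_transpose]

theorem hasDerivAt_exp_mulVec (w : ι → ℝ) (b t : ℝ) :
    HasDerivAt (fun t : ℝ => exp ((b - t) • A) *ᵥ w) (-(A *ᵥ exp ((b - t) • A) *ᵥ w)) t := by
  simp_rw [exp_mulVec_eq_vecMul_exp_neg_transpose]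
  simpa [Matrix.vecMul_neg, Matrix.vecMul_transpose] using hasDerivAt_vecMul_exp (-Aᵀ) w b t

variable {A} {u : ℝ → ι → ℝ} {a : ℝ}

theorem eq_vecMul_exp_of_hasDerivWithinAt (hs : Convex ℝ s)
    (hu : ∀ t ∈ s, HasDerivWithinAt u (u t ᵥ* A) s t) (ha : a ∈ s) (ht : t ∈ s) :
    u t = u a ᵥ* exp ((t - a) • A) := by
  have hconst : ∀ x ∈ s, HasDerivWithinAt (fun x => u x ᵥ* exp ((x - a) • -A)) 0 s x :=
    fun x hx => by
      have hcomm : exp ((x - a) • -A) * -A = -(A * exp ((x - a) • -A)) := by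
        rw [mul_neg, (((Commute.refl A).neg_left).smul_left _).exp_left.eq]
      refine (hasDerivWithinAt_vecMul (hu x hx)
        (hasDerivAt_exp_sub_const_smul (-A) a x).hasDerivWithinAt).congr_deriv ?_
      refine (congrArg (_ + u x ᵥ* ·) hcomm).trans ?_
      rw [Matrix.vecMul_neg, ← Matrix.vecMul_vecMul]
      exact add_neg_cancel _
  have heq : u t ᵥ* exp ((t - a) • -A) = u a := by
    simpa [sub_eq_zero] using
      hs.norm_image_sub_le_of_norm_hasDerivWithin_le hconst (C := 0) (by simp) ha ht
  have hinv : exp ((t - a) • -A) * exp ((t - a) • A) = 1 := by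
    have h := exp_sub_smul_mul_exp_sub_smul A t a t
    rwa [sub_self, zero_smul, exp_zero, ← neg_sub, neg_smul, ← smul_neg] at h
  rw [← heq, Matrix.vecMul_vecMul, hinv, Matrix.vecMul_one]

theorem eq_exp_mulVec_of_hasDerivWithinAt (hs : Convex ℝ s)
    (hu : ∀ t ∈ s, HasDerivWithinAt u (-(A *ᵥ u t)) s t) (ha : a ∈ s) (ht : t ∈ s) :
    u t = exp ((a - t) • A) *ᵥ u a := by
  rw [exp_mulVec_eq_vecMul_exp_neg_transpose]
  refine eq_vecMul_exp_of_hasDerivWithinAt hs (fun x hx => ?_) ha ht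
  rw [Matrix.vecMul_neg, Matrix.vecMul_transpose]
  exact hu x hx

end LinearODE

section StepPaths

variable {E : Type*} {T : ℝ} {y : ℝ → E} {S : ℕ} {τ : ℕ → ℝ}

theorem mem_piece_iff (hlt : ∀ s < S, τ s < τ (s + 1)) (hle : τ S ≤ T) {s : ℕ} {t : ℝ} :
    t ∈ piece T S τ s ↔ τ s ≤ t ∧ t ≤ T ∧ (s < S → t < τ (s + 1)) := by
  unfold piece
  split_ifs with h
  · have hnext : τ (s + 1) ≤ T :=
      ((strictMonoOn_Iic_of_lt_succ hlt).monotoneOn (mem_Iic.2 h) (mem_Iic.2 le_rfl) h).trans hle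
    simp only [mem_Ico, h, forall_const]
    exact ⟨fun ⟨h₁, h₂⟩ => ⟨h₁, h₂.le.trans hnext, h₂⟩, fun ⟨h₁, _, h₂⟩ => ⟨h₁, h₂⟩⟩
  · simp [h]

theorem convex_piece (T : ℝ) (S : ℕ) (τ : ℕ → ℝ) (s : ℕ) : Convex ℝ (piece T S τ s) := by
  unfold piece
  split_ifs
  · exact convex_Ico _ _
  · exact convex_Icc _ _

/-- Increasing enumeration of the natural numbers other than `q + 1`: it is used to remove the
`(q + 1)`-st point from a partition. -/
def skip (q k : ℕ) : ℕ := if k ≤ q then k else k + 1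

theorem skip_of_le {q k : ℕ} (h : k ≤ q) : skip q k = k := if_pos h

theorem skip_of_lt {q k : ℕ} (h : q < k) : skip q k = k + 1 := if_neg h.not_ge

theorem strictMono_skip (q : ℕ) : StrictMono (skip q) :=
  strictMono_nat_of_lt_succ fun k => by unfold skip; split_ifs <;> omega

theorem skip_comp_lt_succ {q : ℕ} (hlt : ∀ s < S + 1, τ s < τ (s + 1)) :
    ∀ s < S, τ (skip q s) < τ (skip q (s + 1)) := fun s hs => by
  have hskip : ∀ k ≤ S, skip q k ≤ S + 1 := fun k hk => by unfold skip; split_ifs <;> omega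
  exact strictMonoOn_Iic_of_lt_succ hlt (hskip s hs.le) (hskip (s + 1) hs)
    (strictMono_skip q s.lt_succ_self)

theorem skip_comp_last_le {q : ℕ} (hq : q < S + 1) (hlt : ∀ s < S + 1, τ s < τ (s + 1))
    (hle : τ (S + 1) ≤ T) : τ (skip q S) ≤ T := by
  rcases (Nat.lt_succ_iff.1 hq).eq_or_lt with rfl | h
  · rw [skip_of_le le_rfl]
    exact (hlt q q.lt_succ_self).le.trans hle
  · rwa [skip_of_lt h]

theorem ConstOnPieces.comp_skip {q : ℕ} (hq : q < S + 1) (hlt : ∀ s < S + 1, τ s < τ (s + 1))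
    (hle : τ (S + 1) ≤ T) (hc : ConstOnPieces T y (S + 1) τ) (hyq : y (τ (q + 1)) = y (τ q)) :
    ConstOnPieces T y S (τ ∘ skip q) := by
  intro s hs t ht
  obtain ⟨h₁, h₂, h₃⟩ :=
    (mem_piece_iff (skip_comp_lt_succ hlt) (skip_comp_last_le hq hlt hle)).1 ht
  simp only [Function.comp_apply] at h₁ h₃ ⊢
  have key : ∀ k ≤ S + 1, τ k ≤ t → (k < S + 1 → t < τ (k + 1)) → y t = y (τ k) :=
    fun k hk h h' => hc k hk t ((mem_piece_iff hlt hle).2 ⟨h, h₂, h'⟩)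
  rcases lt_trichotomy s q with hsq | rfl | hsq
  · rw [skip_of_le hsq.le] at h₁ ⊢
    rw [skip_of_le (show s + 1 ≤ q from hsq)] at h₃
    exact key s (by omega) h₁ fun _ => h₃ (by omega)
  · rw [skip_of_le le_rfl] at h₁ ⊢
    rw [skip_of_lt s.lt_succ_self] at h₃
    rcases lt_or_ge t (τ (s + 1)) with h | h
    · exact key s (by omega) h₁ fun _ => h
    · exact (key (s + 1) hq h fun h' => h₃ (by omega)).trans hyq
  · rw [skip_of_lt hsq] at h₁ ⊢
    rw [skip_of_lt (hsq.trans s.lt_succ_self)] at h₃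
    exact key (s + 1) (by omega) h₁ fun h' => h₃ (by omega)

theorem exists_isJumpPartition (h0 : τ 0 = 0) (hlt : ∀ s < S, τ s < τ (s + 1)) (hle : τ S ≤ T)
    (hc : ConstOnPieces T y S τ) : ∃ S' τ', IsJumpPartition T y S' τ' := by
  induction S generalizing τ with
  | zero => exact ⟨0, τ, h0, hlt, hle, hc, by simp⟩
  | succ S ih =>
    by_cases hne : ∀ s < S + 1, y (τ (s + 1)) ≠ y (τ s)
    · exact ⟨S + 1, τ, h0, hlt, hle, hc, hne⟩
    · push Not at hne
      obtain ⟨q, hq, hyq⟩ := hne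
      exact ih (τ := τ ∘ skip q) (by simp [skip, h0]) (skip_comp_lt_succ hlt)
        (skip_comp_last_le hq hlt hle) (hc.comp_skip hq hlt hle hyq)

/-- The index `s ≤ S` of the piece of the partition `τ 0 < ... < τ S` of `[0, T]` that contains
`t`. -/
def pieceIndex (S : ℕ) (τ : ℕ → ℝ) (t : ℝ) : ℕ :=
  open Classical in Nat.findGreatest (fun s => τ s ≤ t) S

theorem pieceIndex_le (t : ℝ) : pieceIndex S τ t ≤ S := by
  classical exact Nat.findGreatest_le _

theorem le_pieceIndex {s : ℕ} (hs : s ≤ S) {t : ℝ} (h : τ s ≤ t) : s ≤ pieceIndex S τ t := by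
  classical exact Nat.le_findGreatest hs h

theorem lt_of_pieceIndex_lt {s : ℕ} (hs : s ≤ S) {t : ℝ} (h : pieceIndex S τ t < s) : t < τ s := by
  contrapose! h
  exact le_pieceIndex hs h

namespace IsJumpPartition

theorem monotoneOn (hp : IsJumpPartition T y S τ) : MonotoneOn τ (Iic S) :=
  (strictMonoOn_Iic_of_lt_succ hp.lt).monotoneOn

theorem mem_Icc (hp : IsJumpPartition T y S τ) {s : ℕ} (hs : s ≤ S) : τ s ∈ Icc 0 T :=
  ⟨hp.zero ▸ hp.monotoneOn (Nat.zero_le S) hs (Nat.zero_le s),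
    (hp.monotoneOn hs (mem_Iic.2 le_rfl) hs).trans hp.le⟩

theorem nonneg (hp : IsJumpPartition T y S τ) : 0 ≤ T :=
  (hp.mem_Icc le_rfl).1.trans hp.le

theorem mem_piece_iff (hp : IsJumpPartition T y S τ) {s : ℕ} {t : ℝ} :
    t ∈ piece T S τ s ↔ τ s ≤ t ∧ t ≤ T ∧ (s < S → t < τ (s + 1)) :=
  CTHMM.mem_piece_iff hp.lt hp.le

theorem left_mem_piece (hp : IsJumpPartition T y S τ) {s : ℕ} (hs : s ≤ S) : τ s ∈ piece T S τ s :=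
  hp.mem_piece_iff.2 ⟨le_rfl, (hp.mem_Icc hs).2, hp.lt s⟩

theorem pieceIndex_spec (hp : IsJumpPartition T y S τ) {t : ℝ} (ht : 0 ≤ t) :
    τ (pieceIndex S τ t) ≤ t := by
  classical
  exact Nat.findGreatest_spec (P := fun s => τ s ≤ t) (Nat.zero_le S) (hp.zero.trans_le ht)

theorem mem_piece (hp : IsJumpPartition T y S τ) {t : ℝ} (ht : t ∈ Icc 0 T) :
    t ∈ piece T S τ (pieceIndex S τ t) :=
  hp.mem_piece_iff.2
    ⟨hp.pieceIndex_spec ht.1, ht.2, fun h => lt_of_pieceIndex_lt h (Nat.lt_succ_self _)⟩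

theorem eq_pieceIndex (hp : IsJumpPartition T y S τ) {t : ℝ} (ht : t ∈ Icc 0 T) :
    y t = y (τ (pieceIndex S τ t)) :=
  hp.const _ (pieceIndex_le t) t (hp.mem_piece ht)

theorem pieceIndex_eq (hp : IsJumpPartition T y S τ) {s : ℕ} (hs : s ≤ S) {t : ℝ}
    (ht : t ∈ piece T S τ s) : pieceIndex S τ t = s := by
  obtain ⟨hst, -, hts⟩ := hp.mem_piece_iff.1 ht
  refine le_antisymm ?_ (le_pieceIndex hs hst)
  by_contra! h
  have hmono := hp.monotoneOn (mem_Iic.2 (h.trans_le (pieceIndex_le t))) (pieceIndex_le t) h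
  exact (hts (h.trans_le (pieceIndex_le t))).not_ge
    (hmono.trans (hp.pieceIndex_spec ((hp.mem_Icc hs).1.trans hst)))

theorem pieceIndex_left (hp : IsJumpPartition T y S τ) {s : ℕ} (hs : s ≤ S) :
    pieceIndex S τ (τ s) = s :=
  hp.pieceIndex_eq hs (hp.left_mem_piece hs)

theorem pieceIndex_zero (hp : IsJumpPartition T y S τ) : pieceIndex S τ 0 = 0 := by
  simpa only [hp.zero] using hp.pieceIndex_left (Nat.zero_le S)

theorem pieceIndex_last (hp : IsJumpPartition T y S τ) : pieceIndex S τ T = S :=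
  hp.pieceIndex_eq le_rfl (hp.mem_piece_iff.2 ⟨hp.le, le_rfl, fun h => absurd h (lt_irrefl _)⟩)

theorem pieceIndex_mono (hp : IsJumpPartition T y S τ) {t t' : ℝ} (ht : 0 ≤ t) (h : t ≤ t') :
    pieceIndex S τ t ≤ pieceIndex S τ t' :=
  le_pieceIndex (pieceIndex_le t) ((hp.pieceIndex_spec ht).trans h)

theorem pieceIndex_ne_of_ne (hp : IsJumpPartition T y S τ) {t t' : ℝ} (ht : t ∈ Icc 0 T)
    (ht' : t' ∈ Icc 0 T) (h : y t ≠ y t') : pieceIndex S τ t ≠ pieceIndex S τ t' := fun he =>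
  h (by rw [hp.eq_pieceIndex ht, hp.eq_pieceIndex ht', he])

end IsJumpPartition

end StepPaths

section Grid

variable {E : Type*} {T : ℝ} {y : ℝ → E} {S : ℕ} {τ : ℕ → ℝ} {K : ℕ}

/-- The `k`-th point of the uniform grid with `K` cells on `[0, T]`. -/
def grid (T : ℝ) (K k : ℕ) : ℝ := k * T / K

/-- The index of the first point of the uniform grid with `K` cells on `[0, T]` that is at least
`t`. -/
def gridCeil (T : ℝ) (K : ℕ) (t : ℝ) : ℕ := ⌈t * K / T⌉₊

@[simp] theorem grid_zero : grid T K 0 = 0 := by simp [grid]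

theorem grid_mono (hT : 0 ≤ T) : Monotone (grid T K) := fun k l h => by
  unfold grid; gcongr

theorem grid_mem (hT : 0 ≤ T) {k : ℕ} (hk : k ≤ K) : grid T K k ∈ Icc 0 T :=
  ⟨by unfold grid; positivity,
    div_le_of_le_mul₀ K.cast_nonneg hT (by rw [mul_comm]; gcongr)⟩

theorem grid_succ (k : ℕ) : grid T K (k + 1) = grid T K k + T / K := by
  unfold grid; push_cast; ring

@[simp] theorem gridCeil_zero : gridCeil T K 0 = 0 := by simp [gridCeil]

theorem gridCeil_self (hT : 0 < T) : gridCeil T K T = K := by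
  rw [gridCeil, mul_div_cancel_left₀ _ hT.ne', Nat.ceil_natCast]

theorem gridCeil_le_iff (hK : 0 < K) {t : ℝ} (ht : t ∈ Icc 0 T) {k : ℕ} :
    gridCeil T K t ≤ k ↔ t ≤ grid T K k := by
  have hK' : (0 : ℝ) < K := by positivity
  rw [gridCeil, grid, Nat.ceil_le]
  rcases (ht.1.trans ht.2).eq_or_lt with rfl | h
  · obtain rfl : t = 0 := le_antisymm ht.2 ht.1
    simp
  · rw [div_le_iff₀ h, le_div_iff₀ hK']

theorem lt_gridCeil_iff (hK : 0 < K) {t : ℝ} (ht : t ∈ Icc 0 T) {k : ℕ} :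
    k < gridCeil T K t ↔ grid T K k < t := by
  simpa only [not_le] using (gridCeil_le_iff hK ht (k := k)).not

theorem gridCeil_le {t : ℝ} (ht : t ∈ Icc 0 T) : gridCeil T K t ≤ K :=
  Nat.ceil_le.2 (div_le_of_le_mul₀ (ht.1.trans ht.2) K.cast_nonneg
    (by rw [mul_comm]; gcongr; exact ht.2))

theorem le_grid_gridCeil (hK : 0 < K) {t : ℝ} (ht : t ∈ Icc 0 T) : t ≤ grid T K (gridCeil T K t) :=
  (gridCeil_le_iff hK ht).1 le_rfl

theorem gridCeil_mono (hT : 0 ≤ T) : Monotone (gridCeil T K) := fun t t' h => by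
  unfold gridCeil; gcongr

theorem grid_gridCeil_mem {t : ℝ} (ht : t ∈ Icc 0 T) : grid T K (gridCeil T K t) ∈ Icc 0 T :=
  grid_mem (ht.1.trans ht.2) (gridCeil_le ht)

theorem grid_gridCeil_le (hK : 0 < K) {t : ℝ} (ht : t ∈ Icc 0 T) :
    grid T K (gridCeil T K t) ≤ t + T / K := by
  rcases h : gridCeil T K t with _ | k
  · rw [grid_zero]
    exact add_nonneg ht.1 (div_nonneg (ht.1.trans ht.2) (Nat.cast_nonneg K))
  · have hlt : grid T K k < t := (lt_gridCeil_iff hK ht).1 (by omega)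
    rw [grid_succ]
    linarith

theorem tendsto_mesh (T : ℝ) : Tendsto (fun K : ℕ => T / K) atTop (𝓝 0) :=
  tendsto_const_div_atTop_nhds_zero_nat T

theorem tendsto_grid_gridCeil {t : ℝ} (ht : t ∈ Icc 0 T) :
    Tendsto (fun K => grid T K (gridCeil T K t)) atTop (𝓝 t) := by
  have h : Tendsto (fun K : ℕ => t + T / K) atTop (𝓝 t) := by
    simpa using (tendsto_mesh T).const_add t
  refine tendsto_of_tendsto_of_tendsto_of_le_of_le' tendsto_const_nhds h ?_ ?_
  · filter_upwards [eventually_gt_atTop 0] with K hK using le_grid_gridCeil hK ht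
  · filter_upwards [eventually_gt_atTop 0] with K hK using grid_gridCeil_le hK ht

theorem eventually_gridCeil_lt {t t' : ℝ} (ht : 0 ≤ t) (h : t < t') (ht' : t' ≤ T) :
    ∀ᶠ K in atTop, gridCeil T K t < gridCeil T K t' := by
  filter_upwards [eventually_gt_atTop 0,
    (tendsto_grid_gridCeil ⟨ht, h.le.trans ht'⟩).eventually_lt_const h] with K hK hlt
  exact (lt_gridCeil_iff hK ⟨ht.trans h.le, ht'⟩).2 hlt

theorem IsJumpPartition.eventually_pieceIndex_gridCeil (hp : IsJumpPartition T y S τ) {t : ℝ}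
    (ht : t ∈ Icc 0 T) :
    ∀ᶠ K in atTop, pieceIndex S τ (grid T K (gridCeil T K t)) = pieceIndex S τ t := by
  have h : ∀ᶠ K in atTop, pieceIndex S τ t < S →
      grid T K (gridCeil T K t) < τ (pieceIndex S τ t + 1) := by
    by_cases hS : pieceIndex S τ t < S
    · filter_upwards [(tendsto_grid_gridCeil ht).eventually_lt_const
        (lt_of_pieceIndex_lt hS (Nat.lt_succ_self _))] with K hK _ using hK
    · exact .of_forall fun K h => absurd h hS
  filter_upwards [eventually_gt_atTop 0, h] with K hK hlt
  exact hp.pieceIndex_eq (pieceIndex_le t) (hp.mem_piece_iff.2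
    ⟨(hp.pieceIndex_spec ht.1).trans (le_grid_gridCeil hK ht), (grid_gridCeil_mem ht).2, hlt⟩)

theorem IsJumpPartition.eventually_grid_gridCeil (hp : IsJumpPartition T y S τ) {t : ℝ}
    (ht : t ∈ Icc 0 T) : ∀ᶠ K in atTop, y (grid T K (gridCeil T K t)) = y t := by
  filter_upwards [hp.eventually_pieceIndex_gridCeil ht] with K h
  rw [hp.eq_pieceIndex (grid_gridCeil_mem ht), h, ← hp.eq_pieceIndex ht]

end Grid

section Changes

variable {E : Type*} [DecidableEq E]

/-- The number of indices `l < k` at which the sequence `x` changes value. -/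
def changes (x : ℕ → E) (k : ℕ) : ℕ :=
  ∑ l ∈ Finset.range k, if x l = x (l + 1) then 0 else 1

theorem changes_succ (x : ℕ → E) (k : ℕ) :
    changes x (k + 1) = changes x k + if x k = x (k + 1) then 0 else 1 :=
  Finset.sum_range_succ _ _

@[simp] theorem changes_zero (x : ℕ → E) : changes x 0 = 0 := by
  simp [changes]

theorem changes_mono (x : ℕ → E) : Monotone (changes x) :=
  monotone_nat_of_le_succ fun k => by rw [changes_succ]; exact Nat.le_add_right _ _

theorem exists_changes_eq (x : ℕ → E) {k s : ℕ} (hs : s ≤ changes x k) :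
    ∃ l ≤ k, changes x l = s := by
  induction k with
  | zero => exact ⟨0, le_rfl, by simp_all⟩
  | succ k ih =>
    rcases hs.eq_or_lt with rfl | hlt
    · exact ⟨k + 1, le_rfl, rfl⟩
    · rw [changes_succ] at hlt
      obtain ⟨l, hl, h⟩ := ih (by split_ifs at hlt <;> omega)
      exact ⟨l, by omega, h⟩

theorem eq_of_changes_eq {x : ℕ → E} {k k' : ℕ} (h : changes x k = changes x k') :
    x k = x k' := by
  wlog hk : k ≤ k' generalizing k k'
  · exact (this h.symm (le_of_not_ge hk)).symm
  induction k', hk using Nat.le_induction with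
  | base => rfl
  | succ l hl ih =>
    have hmono := changes_mono x hl
    rw [changes_succ] at h
    split_ifs at h with he
    · rw [ih h, he]
    · omega

theorem changes_lt_of_ne {x : ℕ → E} {k k' : ℕ} (hk : k ≤ k') (h : x k ≠ x k') :
    changes x k < changes x k' :=
  (changes_mono x hk).lt_of_ne fun he => h (eq_of_changes_eq he)

namespace IsJumpPartition

variable {T : ℝ} {y : ℝ → E} {S : ℕ} {τ : ℕ → ℝ} {K : ℕ}

theorem changes_add_pieceIndex_le (hp : IsJumpPartition T y S τ) {k k' : ℕ} (h : k ≤ k')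
    (hk' : k' ≤ K) :
    changes (fun l => y (grid T K l)) k' + pieceIndex S τ (grid T K k) ≤
      changes (fun l => y (grid T K l)) k + pieceIndex S τ (grid T K k') := by
  induction k', h using Nat.le_induction with
  | base => rfl
  | succ l _ ih =>
    have hmem := grid_mem hp.nonneg (Nat.le_of_succ_le hk')
    have hmono := hp.pieceIndex_mono hmem.1 (grid_mono hp.nonneg l.le_succ)
    have hle := ih (Nat.le_of_succ_le hk')
    rw [changes_succ]
    split_ifs with he
    · simp only [Nat.succ_eq_add_one] at hmono; omega
    · have hne := hp.pieceIndex_ne_of_ne hmem (grid_mem hp.nonneg hk') he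
      simp only [Nat.succ_eq_add_one] at hmono; omega

theorem changes_eq_pieceIndex (hp : IsJumpPartition T y S τ)
    (hS : changes (fun l => y (grid T K l)) K = S) {k : ℕ} (hk : k ≤ K) :
    changes (fun l => y (grid T K l)) k = pieceIndex S τ (grid T K k) := by
  have hbefore := hp.changes_add_pieceIndex_le (Nat.zero_le k) hk
  have hafter := hp.changes_add_pieceIndex_le hk le_rfl
  have hle : pieceIndex S τ (grid T K K) ≤ S := pieceIndex_le _
  simp only [grid_zero, changes_zero, hp.pieceIndex_zero] at hbefore
  omega

theorem eventually_le_changes (hp : IsJumpPartition T y S τ) {s : ℕ} (hs : s ≤ S) :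
    ∀ᶠ K in atTop, s ≤ changes (fun l => y (grid T K l)) (gridCeil T K (τ s)) := by
  induction s with
  | zero => exact .of_forall fun K => Nat.zero_le _
  | succ s ih =>
    have hmem := hp.mem_Icc (Nat.le_of_succ_le hs)
    have hmem' := hp.mem_Icc hs
    filter_upwards [ih (Nat.le_of_succ_le hs), hp.eventually_grid_gridCeil hmem,
      hp.eventually_grid_gridCeil hmem',
      eventually_gridCeil_lt hmem.1 (hp.lt s hs) hmem'.2] with K hle hys hys' hlt
    refine Nat.succ_le_of_lt (hle.trans_lt (changes_lt_of_ne hlt.le ?_))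
    simp only [hys, hys']
    exact (hp.ne s hs).symm

theorem eventually_changes_eq (hp : IsJumpPartition T y S τ) :
    ∀ᶠ K in atTop, changes (fun l => y (grid T K l)) K = S := by
  filter_upwards [hp.eventually_le_changes le_rfl] with K hle
  refine le_antisymm ?_ (hle.trans (changes_mono _ (gridCeil_le (hp.mem_Icc le_rfl))))
  have h := hp.changes_add_pieceIndex_le (Nat.zero_le K) le_rfl
  rw [grid_zero, hp.pieceIndex_zero, changes_zero, add_zero, zero_add] at h
  exact h.trans (pieceIndex_le _)

end IsJumpPartition

end Changes

section Propagator

variable {ι : Type*} [Fintype ι] [DecidableEq ι]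

/-- The propagator from time `a` in the piece with index `p` to time `b` in the piece with index
`p + d`, of the piecewise linear equation with coefficient matrix `H s` on the piece with index `s`
and jump matrix `J s` at time `τ s`. It acts on row vectors from the right in the direction of time
and on column vectors from the left against it. -/
def propagator (H J : ℕ → Matrix ι ι ℝ) (τ : ℕ → ℝ) : ℕ → ℕ → ℝ → ℝ → Matrix ι ι ℝ
  | p, 0, a, b => exp ((b - a) • H p)
  | p, d + 1, a, b =>
    exp ((τ (p + 1) - a) • H p) * J (p + 1) * propagator H J τ (p + 1) d (τ (p + 1)) b

variable {H J : ℕ → Matrix ι ι ℝ} {τ : ℕ → ℝ}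

theorem propagator_self (p : ℕ) (a : ℝ) : propagator H J τ p 0 a a = 1 := by
  rw [propagator, sub_self, zero_smul, exp_zero]

theorem exp_mul_propagator (p d : ℕ) (a b c : ℝ) :
    exp ((b - a) • H p) * propagator H J τ p d b c = propagator H J τ p d a c := by
  cases d with
  | zero => exact exp_sub_smul_mul_exp_sub_smul (H p) a b c
  | succ d =>
    rw [propagator, propagator, ← mul_assoc, ← mul_assoc]
    exact congrArg (· * _ * _) (exp_sub_smul_mul_exp_sub_smul (H p) a b _)

theorem propagator_mul_propagator (p d e : ℕ) (a b c : ℝ) :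
    propagator H J τ p d a b * propagator H J τ (p + d) e b c =
      propagator H J τ p (d + e) a c := by
  induction d generalizing p a with
  | zero => rw [zero_add]; exact exp_mul_propagator p e a b c
  | succ d ih =>
    rw [Nat.succ_add, propagator, propagator, mul_assoc, ← ih, Nat.add_right_comm p 1 d, add_assoc]

end Propagator

section Flow

variable {ι E : Type*} [Fintype ι] [DecidableEq ι] {H J : ℕ → Matrix ι ι ℝ} {T : ℝ} {y : ℝ → E}
  {S : ℕ} {τ : ℕ → ℝ} {u : ℝ → ι → ℝ}

/-- The propagator from time `a` to time `b`, for a partition `τ 0 < ... < τ S` of an interval. -/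
def flow (H J : ℕ → Matrix ι ι ℝ) (S : ℕ) (τ : ℕ → ℝ) (a b : ℝ) : Matrix ι ι ℝ :=
  propagator H J τ (pieceIndex S τ a) (pieceIndex S τ b - pieceIndex S τ a) a b

theorem flow_self (a : ℝ) : flow H J S τ a a = 1 := by
  rw [flow, Nat.sub_self, propagator_self]

namespace IsJumpPartition

theorem flow_mul_flow (hp : IsJumpPartition T y S τ) {a b c : ℝ} (ha : 0 ≤ a) (hab : a ≤ b)
    (hbc : b ≤ c) : flow H J S τ a b * flow H J S τ b c = flow H J S τ a c := by
  obtain ⟨d, hd⟩ := Nat.exists_eq_add_of_le (hp.pieceIndex_mono ha hab)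
  obtain ⟨e, he⟩ := Nat.exists_eq_add_of_le (hp.pieceIndex_mono (ha.trans hab) hbc)
  have h := propagator_mul_propagator (H := H) (J := J) (τ := τ) (pieceIndex S τ a) d e a b c
  rw [flow, flow, flow, he, hd]
  convert h using 2 <;> congr 1 <;> omega

theorem flow_eq_of_mem_piece (hp : IsJumpPartition T y S τ) {s : ℕ} (hs : s ≤ S) {a b : ℝ}
    (ha : a ∈ piece T S τ s) (hb : b ∈ piece T S τ s) :
    flow H J S τ a b = exp ((b - a) • H s) := by
  rw [flow, hp.pieceIndex_eq hs ha, hp.pieceIndex_eq hs hb, Nat.sub_self, propagator]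

theorem flow_succ (hp : IsJumpPartition T y S τ) {s : ℕ} (hs : s < S) {a : ℝ}
    (ha : a ∈ piece T S τ s) :
    flow H J S τ a (τ (s + 1)) = exp ((τ (s + 1) - a) • H s) * J (s + 1) := by
  rw [flow, hp.pieceIndex_eq hs.le ha, hp.pieceIndex_left hs, Nat.succ_eq_add_one,
    Nat.add_sub_cancel_left, propagator, propagator_self, mul_one]

theorem piece_mem_nhdsLT (hp : IsJumpPartition T y S τ) {s : ℕ} (hs : s < S) :
    piece T S τ s ∈ 𝓝[<] τ (s + 1) := by
  rw [piece, if_pos hs]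
  exact Ico_mem_nhdsLT (hp.lt s hs)

theorem eq_vecMul_flow_of_jump (hp : IsJumpPartition T y S τ) {s : ℕ} (hs : s < S)
    (hu : ∀ t ∈ piece T S τ s, u t = u (τ s) ᵥ* flow H J S τ (τ s) t)
    (hjump : ∃ a, Tendsto u (𝓝[<] τ (s + 1)) (𝓝 a) ∧ u (τ (s + 1)) = a ᵥ* J (s + 1)) :
    u (τ (s + 1)) = u (τ s) ᵥ* flow H J S τ (τ s) (τ (s + 1)) := by
  have hmem := hp.left_mem_piece hs.le
  obtain ⟨a, ha, hua⟩ := hjump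
  have hlim : Tendsto u (𝓝[<] τ (s + 1)) (𝓝 (u (τ s) ᵥ* exp ((τ (s + 1) - τ s) • H s))) := by
    refine ((hasDerivAt_vecMul_exp (H s) (u (τ s)) (τ s) (τ (s + 1))).continuousAt.tendsto.mono_left
      nhdsWithin_le_nhds).congr' ?_
    filter_upwards [hp.piece_mem_nhdsLT hs] with t ht
    rw [hu t ht, hp.flow_eq_of_mem_piece hs.le hmem ht]
  rw [hua, tendsto_nhds_unique ha hlim, hp.flow_succ hs hmem, Matrix.vecMul_vecMul]

theorem eq_vecMul_flow (hp : IsJumpPartition T y S τ)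
    (hode : ∀ s ≤ S, ∀ t ∈ piece T S τ s, HasDerivWithinAt u (u t ᵥ* H s) (piece T S τ s) t)
    (hjump : ∀ s, 1 ≤ s → s ≤ S → ∃ a, Tendsto u (𝓝[<] τ s) (𝓝 a) ∧ u (τ s) = a ᵥ* J s)
    {t : ℝ} (ht : t ∈ Icc 0 T) : u t = u 0 ᵥ* flow H J S τ 0 t := by
  have hpiece : ∀ s ≤ S, ∀ t ∈ piece T S τ s, u t = u (τ s) ᵥ* flow H J S τ (τ s) t :=
    fun s hs t ht => by
      rw [hp.flow_eq_of_mem_piece hs (hp.left_mem_piece hs) ht]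
      exact eq_vecMul_exp_of_hasDerivWithinAt (convex_piece T S τ s) (hode s hs)
        (hp.left_mem_piece hs) ht
  have hleft : ∀ s ≤ S, u (τ s) = u 0 ᵥ* flow H J S τ 0 (τ s) := fun s hs => by
    induction s with
    | zero => rw [hp.zero, flow_self, Matrix.vecMul_one]
    | succ s ih =>
      have hs' := Nat.le_of_succ_le hs
      rw [hp.eq_vecMul_flow_of_jump hs (hpiece s hs') (hjump (s + 1) (Nat.le_add_left 1 s) hs),
        ih hs', Matrix.vecMul_vecMul, hp.flow_mul_flow le_rfl (hp.mem_Icc hs').1 (hp.lt s hs).le]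
  have hs := pieceIndex_le (S := S) (τ := τ) t
  rw [hpiece _ hs t (hp.mem_piece ht), hleft _ hs, Matrix.vecMul_vecMul,
    hp.flow_mul_flow le_rfl (hp.mem_Icc hs).1 (hp.pieceIndex_spec ht.1)]

theorem flow_eq_flow_mul_exp (hp : IsJumpPartition T y S τ) {s : ℕ} (hs : s ≤ S) {t : ℝ}
    (ht : t ∈ piece T S τ s) :
    flow H J S τ 0 t = flow H J S τ 0 (τ s) * exp ((t - τ s) • H s) := by
  rw [← hp.flow_eq_of_mem_piece (H := H) (J := J) hs (hp.left_mem_piece hs) ht,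
    hp.flow_mul_flow le_rfl (hp.mem_Icc hs).1 (hp.mem_piece_iff.1 ht).1]

theorem hasDerivWithinAt_vecMul_flow (hp : IsJumpPartition T y S τ) (v : ι → ℝ) {s : ℕ}
    (hs : s ≤ S) {t : ℝ} (ht : t ∈ piece T S τ s) :
    HasDerivWithinAt (fun t => v ᵥ* flow H J S τ 0 t) ((v ᵥ* flow H J S τ 0 t) ᵥ* H s)
      (piece T S τ s) t := by
  have heq : ∀ t ∈ piece T S τ s, v ᵥ* flow H J S τ 0 t =
      (v ᵥ* flow H J S τ 0 (τ s)) ᵥ* exp ((t - τ s) • H s) := fun t ht => by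
    rw [hp.flow_eq_flow_mul_exp hs ht, Matrix.vecMul_vecMul]
  rw [heq t ht]
  exact (hasDerivAt_vecMul_exp (H s) _ (τ s) t).hasDerivWithinAt.congr heq (heq t ht)

theorem vecMul_flow_jump (hp : IsJumpPartition T y S τ) (v : ι → ℝ) {s : ℕ} (hs1 : 1 ≤ s)
    (hs : s ≤ S) : ∃ a, Tendsto (fun t => v ᵥ* flow H J S τ 0 t) (𝓝[<] τ s) (𝓝 a) ∧
      v ᵥ* flow H J S τ 0 (τ s) = a ᵥ* J s := by
  obtain ⟨s, rfl⟩ := Nat.exists_eq_add_of_le' hs1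
  have hmem := hp.left_mem_piece (Nat.le_of_succ_le hs)
  refine ⟨(v ᵥ* flow H J S τ 0 (τ s)) ᵥ* exp ((τ (s + 1) - τ s) • H s), ?_, ?_⟩
  · refine ((hasDerivAt_vecMul_exp (H s) _ (τ s) _).continuousAt.tendsto.mono_left
      nhdsWithin_le_nhds).congr' ?_
    filter_upwards [hp.piece_mem_nhdsLT hs] with t ht
    rw [hp.flow_eq_flow_mul_exp (Nat.le_of_succ_le hs) ht, Matrix.vecMul_vecMul]
  · rw [Matrix.vecMul_vecMul, Matrix.vecMul_vecMul, ← hp.flow_succ hs hmem,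
      hp.flow_mul_flow le_rfl (hp.mem_Icc (Nat.le_of_succ_le hs)).1 (hp.lt s hs).le]

theorem eq_flow_mulVec_of_jump (hp : IsJumpPartition T y S τ) {s : ℕ} (hs : s < S)
    (hu : ∀ t ∈ piece T S τ s, ∀ t' ∈ piece T S τ s, u t = flow H J S τ t t' *ᵥ u t')
    (hjump : Tendsto u (𝓝[<] τ (s + 1)) (𝓝 (J (s + 1) *ᵥ u (τ (s + 1))))) {t : ℝ}
    (ht : t ∈ piece T S τ s) : u t = flow H J S τ t (τ (s + 1)) *ᵥ u (τ (s + 1)) := by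
  have hexp : Tendsto (fun t' => exp ((t' - t) • H s)) (𝓝[<] τ (s + 1))
      (𝓝 (exp ((τ (s + 1) - t) • H s))) :=
    (hasDerivAt_exp_sub_const_smul (H s) t _).continuousAt.tendsto.mono_left nhdsWithin_le_nhds
  have hlim : Tendsto (fun t' => exp ((t' - t) • H s) *ᵥ u t') (𝓝[<] τ (s + 1))
      (𝓝 (exp ((τ (s + 1) - t) • H s) *ᵥ (J (s + 1) *ᵥ u (τ (s + 1))))) :=
    ((Continuous.matrix_mulVec continuous_fst continuous_snd).tendsto (_, _)).comp
      (hexp.prodMk_nhds hjump)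
  rw [hp.flow_succ hs ht, ← Matrix.mulVec_mulVec]
  refine tendsto_nhds_unique (tendsto_const_nhds.congr' ?_) hlim
  filter_upwards [hp.piece_mem_nhdsLT hs] with t' ht'
  rw [hu t ht t' ht', hp.flow_eq_of_mem_piece hs.le ht ht']

theorem eq_flow_mulVec (hp : IsJumpPartition T y S τ)
    (hode : ∀ s ≤ S, ∀ t ∈ piece T S τ s, HasDerivWithinAt u (-(H s *ᵥ u t)) (piece T S τ s) t)
    (hjump : ∀ s, 1 ≤ s → s ≤ S → Tendsto u (𝓝[<] τ s) (𝓝 (J s *ᵥ u (τ s))))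
    {t : ℝ} (ht : t ∈ Icc 0 T) : u t = flow H J S τ t T *ᵥ u T := by
  have hpiece : ∀ s ≤ S, ∀ t ∈ piece T S τ s, ∀ t' ∈ piece T S τ s,
      u t = flow H J S τ t t' *ᵥ u t' := fun s hs t ht t' ht' => by
    rw [hp.flow_eq_of_mem_piece hs ht ht']
    exact eq_exp_mulVec_of_hasDerivWithinAt (convex_piece T S τ s) (hode s hs) ht' ht
  have hback : ∀ d s, s + d = S → ∀ t ∈ piece T S τ s, u t = flow H J S τ t T *ᵥ u T := fun d => by
    induction d with
    | zero =>
      rintro s rfl t ht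
      exact hpiece s le_rfl t ht T (hp.mem_piece_iff.2 ⟨hp.le, le_rfl, fun h => by omega⟩)
    | succ d ih =>
      intro s hsd t ht
      have hs : s < S := by omega
      obtain ⟨hst, -, hts⟩ := hp.mem_piece_iff.1 ht
      rw [hp.eq_flow_mulVec_of_jump hs (hpiece s hs.le) (hjump _ (Nat.le_add_left 1 s) hs) ht,
        ih (s + 1) (by omega) _ (hp.left_mem_piece hs), Matrix.mulVec_mulVec,
        hp.flow_mul_flow ((hp.mem_Icc hs.le).1.trans hst) (hts hs).le (hp.mem_Icc hs).2]
  have hs := pieceIndex_le (S := S) (τ := τ) t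
  exact hback (S - pieceIndex S τ t) _ (Nat.add_sub_cancel' hs) t (hp.mem_piece ht)

theorem flow_eq_exp_mul_flow (hp : IsJumpPartition T y S τ) {s : ℕ} (hs : s ≤ S) {t : ℝ}
    (ht : t ∈ piece T S τ s) :
    flow H J S τ t T = exp ((τ s - t) • H s) * flow H J S τ (τ s) T := by
  obtain ⟨hst, htT, -⟩ := hp.mem_piece_iff.1 ht
  have hinv : exp ((τ s - t) • H s) * exp ((t - τ s) • H s) = 1 := by
    have h := exp_sub_smul_mul_exp_sub_smul (H s) t (τ s) t
    rwa [sub_self, zero_smul, exp_zero] at h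
  rw [← hp.flow_mul_flow (hp.mem_Icc hs).1 hst htT,
    hp.flow_eq_of_mem_piece hs (hp.left_mem_piece hs) ht, ← Matrix.mul_assoc, hinv, Matrix.one_mul]

theorem hasDerivWithinAt_flow_mulVec (hp : IsJumpPartition T y S τ) (w : ι → ℝ) {s : ℕ}
    (hs : s ≤ S) {t : ℝ} (ht : t ∈ piece T S τ s) :
    HasDerivWithinAt (fun t => flow H J S τ t T *ᵥ w) (-(H s *ᵥ (flow H J S τ t T *ᵥ w)))
      (piece T S τ s) t := by
  have heq : ∀ t ∈ piece T S τ s, flow H J S τ t T *ᵥ w =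
      exp ((τ s - t) • H s) *ᵥ (flow H J S τ (τ s) T *ᵥ w) := fun t ht => by
    rw [hp.flow_eq_exp_mul_flow hs ht, Matrix.mulVec_mulVec]
  rw [heq t ht]
  exact (hasDerivAt_exp_mulVec (H s) _ (τ s) t).hasDerivWithinAt.congr heq (heq t ht)

theorem tendsto_flow_mulVec_jump (hp : IsJumpPartition T y S τ) (w : ι → ℝ) {s : ℕ} (hs1 : 1 ≤ s)
    (hs : s ≤ S) : Tendsto (fun t => flow H J S τ t T *ᵥ w) (𝓝[<] τ s)
      (𝓝 (J s *ᵥ (flow H J S τ (τ s) T *ᵥ w))) := by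
  obtain ⟨s, rfl⟩ := Nat.exists_eq_add_of_le' hs1
  have heq : ∀ t ∈ piece T S τ s, flow H J S τ t T *ᵥ w = exp ((τ (s + 1) - t) • H s) *ᵥ
      (J (s + 1) *ᵥ (flow H J S τ (τ (s + 1)) T *ᵥ w)) := fun t ht => by
    obtain ⟨hst, -, hts⟩ := hp.mem_piece_iff.1 ht
    rw [Matrix.mulVec_mulVec, Matrix.mulVec_mulVec, ← hp.flow_succ hs ht, hp.flow_mul_flow
      ((hp.mem_Icc (Nat.le_of_succ_le hs)).1.trans hst) (hts hs).le (hp.mem_Icc hs).2]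
  have h := (hasDerivAt_exp_mulVec (H s) (J (s + 1) *ᵥ (flow H J S τ (τ (s + 1)) T *ᵥ w))
    (τ (s + 1)) (τ (s + 1))).continuousAt.tendsto.mono_left
      (nhdsWithin_le_nhds (s := Iio (τ (s + 1))))
  rw [sub_self, zero_smul, exp_zero, Matrix.one_mulVec] at h
  refine h.congr' ?_
  filter_upwards [hp.piece_mem_nhdsLT hs] with t ht using (heq t ht).symm

end IsJumpPartition

end Flow

section Solutions

variable {n m : ℕ} {T : ℝ} {Q : Matrix (Fin n) (Fin n) ℝ} {r : Fin n → Fin m → ℝ}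
  {π₀ : Fin n → ℝ} {y : ℝ → Fin m} {S : ℕ} {τ : ℕ → ℝ} {α β : ℝ → Fin n → ℝ}

/-- The coefficient matrix `D + (Q - D) R(y)` of both equations while the observation is `y`. -/
def heldRate (Q : Matrix (Fin n) (Fin n) ℝ) (r : Fin n → Fin m → ℝ) (y : Fin m) :
    Matrix (Fin n) (Fin n) ℝ := D Q + (Q - D Q) * R r y

/-- The matrix `(Q - D) R(y)` applied when the observation jumps to `y`. -/
def jumpRate (Q : Matrix (Fin n) (Fin n) ℝ) (r : Fin n → Fin m → ℝ) (y : Fin m) :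
    Matrix (Fin n) (Fin n) ℝ := (Q - D Q) * R r y

/-- The flow of the forward and backward equations along the step path `y`. -/
def obsFlow (Q : Matrix (Fin n) (Fin n) ℝ) (r : Fin n → Fin m → ℝ) (y : ℝ → Fin m)
    (S : ℕ) (τ : ℕ → ℝ) : ℝ → ℝ → Matrix (Fin n) (Fin n) ℝ :=
  flow (fun s => heldRate Q r (y (τ s))) (fun s => jumpRate Q r (y (τ s))) S τ

/-- The solution of the forward equation along `y`. -/
def forward (Q : Matrix (Fin n) (Fin n) ℝ) (r : Fin n → Fin m → ℝ) (π₀ : Fin n → ℝ)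
    (y : ℝ → Fin m) (S : ℕ) (τ : ℕ → ℝ) (t : ℝ) : Fin n → ℝ :=
  (π₀ ᵥ* R r (y 0)) ᵥ* obsFlow Q r y S τ 0 t

/-- The solution of the backward equation along `y`. -/
def backward (T : ℝ) (Q : Matrix (Fin n) (Fin n) ℝ) (r : Fin n → Fin m → ℝ) (y : ℝ → Fin m)
    (S : ℕ) (τ : ℕ → ℝ) (t : ℝ) : Fin n → ℝ :=
  obsFlow Q r y S τ t T *ᵥ 1

namespace IsJumpPartition

theorem isForwardSolution_forward (hp : IsJumpPartition T y S τ) :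
    IsForwardSolution T Q r π₀ y S τ (forward Q r π₀ y S τ) where
  init := by rw [forward, obsFlow, flow_self, Matrix.vecMul_one]
  ode _ hs _ ht := hp.hasDerivWithinAt_vecMul_flow _ hs ht
  jump _ hs1 hs := hp.vecMul_flow_jump _ hs1 hs

theorem eqOn_forward (hp : IsJumpPartition T y S τ) (h : IsForwardSolution T Q r π₀ y S τ α) :
    EqOn α (forward Q r π₀ y S τ) (Icc 0 T) := fun _ ht => by
  rw [forward, ← h.init]
  exact hp.eq_vecMul_flow h.ode h.jump ht

theorem isBackwardSolution_backward (hp : IsJumpPartition T y S τ) :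
    IsBackwardSolution T Q r y S τ (backward T Q r y S τ) where
  final := by rw [backward, obsFlow, flow_self, Matrix.one_mulVec]; rfl
  ode _ hs _ ht := hp.hasDerivWithinAt_flow_mulVec _ hs ht
  jump _ hs1 hs := hp.tendsto_flow_mulVec_jump _ hs1 hs

theorem eqOn_backward (hp : IsJumpPartition T y S τ) (h : IsBackwardSolution T Q r y S τ β) :
    EqOn β (backward T Q r y S τ) (Icc 0 T) := fun _ ht => by
  rw [backward, Pi.one_def, ← h.final]
  exact hp.eq_flow_mulVec h.ode h.jump ht

theorem forward_dotProduct_backward (hp : IsJumpPartition T y S τ) {t : ℝ} (ht : t ∈ Icc 0 T) :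
    forward Q r π₀ y S τ t ⬝ᵥ backward T Q r y S τ t =
      forward Q r π₀ y S τ 0 ⬝ᵥ backward T Q r y S τ 0 := by
  have h : ∀ t ∈ Icc 0 T, forward Q r π₀ y S τ t ⬝ᵥ backward T Q r y S τ t =
      (π₀ ᵥ* R r (y 0)) ⬝ᵥ (obsFlow Q r y S τ 0 T *ᵥ 1) := fun t ht => by
    rw [forward, backward, Matrix.dotProduct_mulVec, Matrix.vecMul_vecMul,
      obsFlow, hp.flow_mul_flow le_rfl ht.1 ht.2, Matrix.dotProduct_mulVec]
  rw [h t ht, h 0 ⟨le_rfl, hp.nonneg⟩]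

end IsJumpPartition

end Solutions

section Generator

variable {n m : ℕ} {P : ℝ → Matrix (Fin n) (Fin n) ℝ} {Q : Matrix (Fin n) (Fin n) ℝ} {T : ℝ}

theorem heldRate_apply (Q : Matrix (Fin n) (Fin n) ℝ) (r : Fin n → Fin m → ℝ) (y : Fin m)
    (i j : Fin n) : heldRate Q r y i j = if i = j then Q i i else Q i j * r j y := by
  simp only [heldRate, D, R, Matrix.add_apply, Matrix.mul_diagonal, Matrix.sub_apply,
    Matrix.diagonal_apply]
  split_ifs with h
  · subst h; ring
  · ring

theorem jumpRate_apply (Q : Matrix (Fin n) (Fin n) ℝ) (r : Fin n → Fin m → ℝ) (y : Fin m)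
    (i j : Fin n) : jumpRate Q r y i j = if i = j then 0 else Q i j * r j y := by
  simp only [jumpRate, D, R, Matrix.mul_diagonal, Matrix.sub_apply, Matrix.diagonal_apply]
  split_ifs with h
  · subst h; ring
  · ring

/-- `P` is a family of stochastic matrices with `P 0 = 1` and right derivative `Q` at `0`. -/
structure HasGenerator (P : ℝ → Matrix (Fin n) (Fin n) ℝ) (Q : Matrix (Fin n) (Fin n) ℝ) :
    Prop where
  zero : P 0 = 1
  stochastic : ∀ h, 0 ≤ h → P h ∈ Matrix.rowStochastic ℝ (Fin n)
  tendsto : ∀ i j, i ≠ j → Tendsto (fun h => P h i j / h) (𝓝[>] 0) (𝓝 (Q i j))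
  diag : ∀ i, Q i i = -∑ j ∈ Finset.univ.erase i, Q i j

theorem isLittleO_of_apply {α : Type*} {l : Filter α} {M : α → Matrix (Fin n) (Fin n) ℝ}
    {d : α → ℝ} (h : ∀ i j, (fun a => M a i j) =o[l] d) : M =o[l] d := by
  have hM : ∀ a, M a = ∑ i, ∑ j, M a i j • Matrix.single i j (1 : ℝ) := fun a => by
    conv_lhs => rw [Matrix.matrix_eq_sum_single (M a)]
    simp only [Matrix.smul_single, smul_eq_mul, mul_one]
  rw [funext hM]
  refine IsLittleO.fun_sum fun i _ => IsLittleO.fun_sum fun j _ =>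
    (IsBigO.of_bound ‖Matrix.single i j (1 : ℝ)‖ (.of_forall fun a => ?_)).trans_isLittleO (h i j)
  rw [norm_smul, mul_comm]

namespace HasGenerator

theorem apply_nonneg (hP : HasGenerator P Q) {h : ℝ} (hh : 0 ≤ h) (i j : Fin n) : 0 ≤ P h i j :=
  Matrix.nonneg_of_mem_rowStochastic (hP.stochastic h hh)

theorem sum_apply (hP : HasGenerator P Q) {h : ℝ} (hh : 0 ≤ h) (i : Fin n) : ∑ j, P h i j = 1 :=
  Matrix.sum_row_of_mem_rowStochastic (hP.stochastic h hh) i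

theorem isLittleO_sub_smul_apply (hP : HasGenerator P Q) {i j : Fin n} (hij : i ≠ j) :
    (fun h => P h i j - h * Q i j) =o[𝓝[≥] 0] fun h => h := by
  rw [← Ioi_insert, nhdsWithin_insert, isLittleO_sup]
  refine ⟨?_, ?_⟩
  · rw [isLittleO_pure, hP.zero, Matrix.one_apply_ne hij, zero_mul, sub_zero]
  · rw [isLittleO_iff_tendsto' (eventually_mem_nhdsWithin.mono fun h hh h0 => (hh.ne' h0).elim)]
    refine (sub_self (Q i j) ▸ (hP.tendsto i j hij).sub_const (Q i j)).congr' ?_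
    filter_upwards [self_mem_nhdsWithin] with h hh
    rw [sub_div, mul_div_cancel_left₀ _ (ne_of_gt hh)]

theorem isLittleO_sub_smul_apply_self (hP : HasGenerator P Q) (i : Fin n) :
    (fun h => P h i i - 1 - h * Q i i) =o[𝓝[≥] 0] fun h => h := by
  refine (IsLittleO.fun_sum fun k (hk : k ∈ Finset.univ.erase i) =>
    hP.isLittleO_sub_smul_apply (Finset.ne_of_mem_erase hk).symm).neg_left.congr' ?_ .rfl
  filter_upwards [self_mem_nhdsWithin] with h hh
  have hsum := hP.sum_apply hh i
  rw [← Finset.add_sum_erase _ _ (Finset.mem_univ i)] at hsum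
  rw [Finset.sum_sub_distrib, ← Finset.mul_sum, hP.diag i]
  linarith

theorem isLittleO_jumpRate (hP : HasGenerator P Q) (r : Fin n → Fin m → ℝ) (y : Fin m) :
    (fun h => jumpRate (P h) r y - h • jumpRate Q r y) =o[𝓝[≥] 0] fun h => h := by
  refine isLittleO_of_apply fun i j => ?_
  rcases eq_or_ne i j with rfl | hij
  · refine (isLittleO_zero _ _).congr_left fun h => ?_
    rw [Matrix.sub_apply, Matrix.smul_apply, jumpRate_apply, jumpRate_apply, if_pos rfl, if_pos rfl,
      smul_zero, sub_zero]
  · refine ((hP.isLittleO_sub_smul_apply hij).const_mul_left (r j y)).congr_left fun h => ?_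
    rw [Matrix.sub_apply, Matrix.smul_apply, jumpRate_apply, jumpRate_apply, if_neg hij, if_neg hij,
      smul_eq_mul]
    ring

theorem isLittleO_heldRate (hP : HasGenerator P Q) (r : Fin n → Fin m → ℝ) (y : Fin m) :
    (fun h => heldRate (P h) r y - 1 - h • heldRate Q r y) =o[𝓝[≥] 0] fun h => h := by
  have hD : (fun h => D (P h) - 1 - h • D Q) =o[𝓝[≥] 0] fun h => h := by
    refine isLittleO_of_apply fun i j => ?_
    rcases eq_or_ne i j with rfl | hij
    · simpa only [D, Matrix.sub_apply, Matrix.smul_apply, Matrix.diagonal_apply_eq,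
        Matrix.one_apply_eq, smul_eq_mul] using hP.isLittleO_sub_smul_apply_self i
    · simpa only [D, Matrix.sub_apply, Matrix.smul_apply, Matrix.diagonal_apply_ne _ hij,
        Matrix.one_apply_ne hij, smul_zero, sub_zero] using isLittleO_zero _ _
  refine (hD.add (hP.isLittleO_jumpRate r y)).congr_left fun h => ?_
  simp only [heldRate, jumpRate, smul_add]
  abel

theorem tendsto_inv_smul_jumpRate (hP : HasGenerator P Q) (r : Fin n → Fin m → ℝ) (y : Fin m) :
    Tendsto (fun h : ℝ => h⁻¹ • jumpRate (P h) r y) (𝓝[>] 0) (𝓝 (jumpRate Q r y)) := by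
  have h := ((hP.isLittleO_jumpRate r y).mono
    (nhdsWithin_mono 0 Ioi_subset_Ici_self)).tendsto_inv_smul_nhds_zero
  rw [← zero_add (jumpRate Q r y)]
  refine (h.add_const (jumpRate Q r y)).congr' ?_
  filter_upwards [self_mem_nhdsWithin] with h hh
  rw [smul_sub, inv_smul_smul₀ (ne_of_gt hh), sub_add_cancel]

end HasGenerator

end Generator

section DiscreteFlow

variable {n m : ℕ} {P : ℝ → Matrix (Fin n) (Fin n) ℝ} {Q : Matrix (Fin n) (Fin n) ℝ}
  {r : Fin n → Fin m → ℝ} {T : ℝ} {y : ℝ → Fin m} {S : ℕ} {τ : ℕ → ℝ}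

/-- The product `N k * N (k + 1) * ⋯ * N (l - 1)`. -/
def stepProd {M : Type*} [Monoid M] (N : ℕ → M) (k l : ℕ) : M := ((List.Ico k l).map N).prod

theorem stepProd_self {M : Type*} [Monoid M] (N : ℕ → M) (k : ℕ) : stepProd N k k = 1 := by
  rw [stepProd, List.Ico.self_empty, List.map_nil, List.prod_nil]

theorem stepProd_mul_stepProd {M : Type*} [Monoid M] (N : ℕ → M) {j k l : ℕ} (hjk : j ≤ k)
    (hkl : k ≤ l) : stepProd N j k * stepProd N k l = stepProd N j l := by
  rw [stepProd, stepProd, stepProd, ← List.prod_append, ← List.map_append,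
    List.Ico.append_consecutive hjk hkl]

theorem stepProd_succ_self {M : Type*} [Monoid M] (N : ℕ → M) (k : ℕ) :
    stepProd N k (k + 1) = N k := by
  rw [stepProd, List.Ico.succ_singleton, List.map_singleton, List.prod_singleton]

theorem stepProd_eq_pow {M : Type*} [Monoid M] {N : ℕ → M} {B : M} {k l : ℕ}
    (h : ∀ i, k ≤ i → i < l → N i = B) : stepProd N k l = B ^ (l - k) := by
  rw [stepProd, ← List.Ico.length k l, ← List.length_map N]
  exact List.prod_eq_pow_card _ _ fun x hx => by
    obtain ⟨i, hi, rfl⟩ := List.mem_map.1 hx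
    exact h i (List.Ico.mem.1 hi).1 (List.Ico.mem.1 hi).2

/-- The transition matrix of the hidden state over one cell of the grid whose end points carry the
observations `y` and `z`, provided that the hidden state jumps at most once in the cell. -/
def stepMatrix (P : Matrix (Fin n) (Fin n) ℝ) (r : Fin n → Fin m → ℝ) (y z : Fin m) :
    Matrix (Fin n) (Fin n) ℝ :=
  if y = z then heldRate P r y else jumpRate P r z

/-- The transition matrix over the `l`-th cell, along the observations `y 0, y 1, ...` at the grid
points. -/
def obsStep (P : Matrix (Fin n) (Fin n) ℝ) (r : Fin n → Fin m → ℝ) (y : ℕ → Fin m) (l : ℕ) :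
    Matrix (Fin n) (Fin n) ℝ :=
  stepMatrix P r (y l) (y (l + 1))

/-- The transition matrices over the cells of the uniform grid with `K` cells on `[0, T]`, along the
observed path `y`. -/
def gridStep (T : ℝ) (P : ℝ → Matrix (Fin n) (Fin n) ℝ) (r : Fin n → Fin m → ℝ) (y : ℝ → Fin m)
    (K : ℕ) : ℕ → Matrix (Fin n) (Fin n) ℝ :=
  obsStep (P (T / K)) r fun l => y (grid T K l)

/-- The discrete counterpart of `obsFlow`. Each jump of the observed path between `a` and `b`
contributes a factor of the order of the mesh `T / K`. -/
def gridFlow (T : ℝ) (P : ℝ → Matrix (Fin n) (Fin n) ℝ) (r : Fin n → Fin m → ℝ) (y : ℝ → Fin m)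
    (K : ℕ) (a b : ℝ) : Matrix (Fin n) (Fin n) ℝ :=
  stepProd (gridStep T P r y K) (gridCeil T K a) (gridCeil T K b)

theorem gridFlow_mul_gridFlow (hT : 0 ≤ T) (K : ℕ) {a b c : ℝ} (hab : a ≤ b) (hbc : b ≤ c) :
    gridFlow T P r y K a b * gridFlow T P r y K b c = gridFlow T P r y K a c :=
  stepProd_mul_stepProd _ (gridCeil_mono hT hab) (gridCeil_mono hT hbc)

theorem tendsto_mesh_nhdsGE (hT : 0 ≤ T) : Tendsto (fun K : ℕ => T / K) atTop (𝓝[≥] 0) :=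
  tendsto_nhdsWithin_iff.2 ⟨tendsto_mesh T, .of_forall fun _ => div_nonneg hT (Nat.cast_nonneg _)⟩

theorem tendsto_mesh_nhdsGT (hT : 0 < T) : Tendsto (fun K : ℕ => T / K) atTop (𝓝[>] 0) :=
  tendsto_nhdsWithin_iff.2 ⟨tendsto_mesh T, (eventually_gt_atTop 0).mono fun _ hK =>
    div_pos hT (Nat.cast_pos.2 hK)⟩

theorem grid_sub_grid {K k l : ℕ} (h : k ≤ l) :
    grid T K l - grid T K k = (l - k : ℕ) * (T / K) := by
  rw [grid, grid, Nat.cast_sub h]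
  ring

theorem HasGenerator.tendsto_heldRate_pow (hP : HasGenerator P Q) (hT : 0 ≤ T) (z : Fin m)
    {k l : ℕ → ℕ} (hkl : ∀ᶠ K in atTop, k K ≤ l K) {a b : ℝ}
    (hk : Tendsto (fun K => grid T K (k K)) atTop (𝓝 a))
    (hl : Tendsto (fun K => grid T K (l K)) atTop (𝓝 b)) :
    Tendsto (fun K : ℕ => heldRate (P (T / K)) r z ^ (l K - k K)) atTop
      (𝓝 (exp ((b - a) • heldRate Q r z))) := by
  refine tendsto_pow_exp_smul _ (tendsto_mesh T) (fun K => div_nonneg hT K.cast_nonneg)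
    ((hP.isLittleO_heldRate r z).comp_tendsto (tendsto_mesh_nhdsGE hT)) ?_
  exact (hl.sub hk).congr' (hkl.mono fun K h => grid_sub_grid h)

namespace IsJumpPartition

theorem stepProd_gridStep_of_mem_piece (hp : IsJumpPartition T y S τ) {K k l s : ℕ} (hs : s ≤ S)
    (hk : grid T K k ∈ piece T S τ s) (hl : grid T K l ∈ piece T S τ s) :
    stepProd (gridStep T P r y K) k l = heldRate (P (T / K)) r (y (τ s)) ^ (l - k) := by
  refine stepProd_eq_pow fun i hki hil => ?_
  have hmem : ∀ j, k ≤ j → j ≤ l → grid T K j ∈ piece T S τ s := fun j hkj hjl =>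
    (convex_piece T S τ s).ordConnected.out hk hl ⟨grid_mono hp.nonneg hkj, grid_mono hp.nonneg hjl⟩
  rw [gridStep, obsStep, hp.const s hs _ (hmem i hki hil.le),
    hp.const s hs _ (hmem (i + 1) (hki.trans i.le_succ) hil), stepMatrix, if_pos rfl]

theorem eventually_grid_gridCeil_mem_piece (hp : IsJumpPartition T y S τ) {s : ℕ} (hs : s ≤ S)
    {t : ℝ} (ht : t ∈ piece T S τ s) :
    ∀ᶠ K in atTop, grid T K (gridCeil T K t) ∈ piece T S τ s := by
  have ht' : t ∈ Icc 0 T :=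
    ⟨(hp.mem_Icc hs).1.trans (hp.mem_piece_iff.1 ht).1, (hp.mem_piece_iff.1 ht).2.1⟩
  filter_upwards [hp.eventually_pieceIndex_gridCeil ht'] with K hK
  rw [← hp.pieceIndex_eq hs ht, ← hK]
  exact hp.mem_piece (grid_gridCeil_mem ht')

theorem tendsto_gridFlow_of_mem_piece (hp : IsJumpPartition T y S τ) (hP : HasGenerator P Q)
    {s : ℕ} (hs : s ≤ S) {a b : ℝ} (hab : a ≤ b) (ha : a ∈ piece T S τ s)
    (hb : b ∈ piece T S τ s) :
    Tendsto (fun K => gridFlow T P r y K a b) atTop (𝓝 (obsFlow Q r y S τ a b)) := by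
  have ha0 := (hp.mem_Icc hs).1.trans (hp.mem_piece_iff.1 ha).1
  have hbT := (hp.mem_piece_iff.1 hb).2.1
  rw [obsFlow, hp.flow_eq_of_mem_piece hs ha hb]
  refine (hP.tendsto_heldRate_pow hp.nonneg _ ?_ (tendsto_grid_gridCeil ⟨ha0, hab.trans hbT⟩)
    (tendsto_grid_gridCeil ⟨ha0.trans hab, hbT⟩)).congr' ?_
  · exact .of_forall fun K => gridCeil_mono hp.nonneg hab
  · filter_upwards [hp.eventually_grid_gridCeil_mem_piece hs ha,
      hp.eventually_grid_gridCeil_mem_piece hs hb] with K hKa hKb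
    rw [gridFlow, hp.stepProd_gridStep_of_mem_piece hs hKa hKb]

theorem gridFlow_succ (hp : IsJumpPartition T y S τ) {K k s : ℕ} (hK : 0 < K) (hs : s < S) {a : ℝ}
    (ha : a ∈ piece T S τ s) (hk : gridCeil T K (τ (s + 1)) = k + 1) (hak : gridCeil T K a ≤ k)
    (hks : y (grid T K (k + 1)) = y (τ (s + 1))) :
    gridFlow T P r y K a (τ (s + 1)) =
      heldRate (P (T / K)) r (y (τ s)) ^ (k - gridCeil T K a) *
        jumpRate (P (T / K)) r (y (τ (s + 1))) := by
  have ha' : a ∈ Icc 0 T :=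
    ⟨(hp.mem_Icc hs.le).1.trans (hp.mem_piece_iff.1 ha).1, (hp.mem_piece_iff.1 ha).2.1⟩
  have hleft : grid T K (gridCeil T K a) ∈ piece T S τ s ∧ grid T K k ∈ piece T S τ s := by
    have hkτ : grid T K k < τ (s + 1) :=
      (lt_gridCeil_iff hK (hp.mem_Icc hs)).1 (hk ▸ k.lt_succ_self)
    have hle := grid_mono (K := K) hp.nonneg hak
    have hsa := (hp.mem_piece_iff.1 ha).1.trans (le_grid_gridCeil hK ha')
    rw [piece, if_pos hs]
    exact ⟨⟨hsa, hle.trans_lt hkτ⟩, hsa.trans hle, hkτ⟩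
  rw [gridFlow, hk, ← stepProd_mul_stepProd _ hak k.le_succ, stepProd_succ_self,
    hp.stepProd_gridStep_of_mem_piece hs.le hleft.1 hleft.2, gridStep, obsStep, stepMatrix,
    hp.const s hs.le _ hleft.2, hks, if_neg (hp.ne s hs).symm]

theorem tendsto_gridFlow_succ (hp : IsJumpPartition T y S τ) (hP : HasGenerator P Q)
    {s : ℕ} (hs : s < S) {a : ℝ} (ha : a ∈ piece T S τ s) :
    Tendsto (fun K : ℕ => (T / K)⁻¹ • gridFlow T P r y K a (τ (s + 1))) atTop
      (𝓝 (obsFlow Q r y S τ a (τ (s + 1)))) := by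
  obtain ⟨hsa, haT, haτ⟩ := hp.mem_piece_iff.1 ha
  have ha' : a ∈ Icc 0 T := ⟨(hp.mem_Icc hs.le).1.trans hsa, haT⟩
  have hτ := hp.mem_Icc hs
  have hT : 0 < T := (ha'.1.trans_lt (haτ hs)).trans_le hτ.2
  have hlt := eventually_gridCeil_lt ha'.1 (haτ hs) hτ.2
  have hpred : Tendsto (fun K => grid T K (gridCeil T K (τ (s + 1)) - 1)) atTop
      (𝓝 (τ (s + 1))) := by
    refine (sub_zero (τ (s + 1)) ▸
      (tendsto_grid_gridCeil hτ).sub (tendsto_mesh T)).congr' ?_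
    filter_upwards [hlt] with K hK
    rw [← Nat.sub_add_cancel (Nat.one_le_of_lt hK), grid_succ, Nat.add_sub_cancel,
      add_sub_cancel_right]
  have hheld := hP.tendsto_heldRate_pow (r := r) hT.le (y (τ s))
    (hlt.mono fun K h => Nat.le_sub_one_of_lt h) (tendsto_grid_gridCeil ha') hpred
  rw [obsFlow, hp.flow_succ hs ha]
  refine (hheld.mul ((hP.tendsto_inv_smul_jumpRate r (y (τ (s + 1)))).comp
    (tendsto_mesh_nhdsGT hT))).congr' ?_
  filter_upwards [hlt, hp.eventually_grid_gridCeil hτ, eventually_gt_atTop 0] with K hK hKy hK0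
  obtain ⟨k, hk⟩ := Nat.exists_eq_add_of_le' (Nat.one_le_of_lt hK)
  rw [hk] at hKy hK
  rw [hp.gridFlow_succ hK0 hs ha hk (Nat.lt_succ_iff.1 hK) hKy, hk, Nat.add_sub_cancel,
    Function.comp, Matrix.mul_smul]

theorem tendsto_gridFlow (hp : IsJumpPartition T y S τ) (hP : HasGenerator P Q) {a b : ℝ}
    (ha : 0 ≤ a) (hab : a ≤ b) (hb : b ≤ T) :
    Tendsto (fun K : ℕ => ((T / K) ^ (pieceIndex S τ b - pieceIndex S τ a))⁻¹ •
      gridFlow T P r y K a b) atTop (𝓝 (obsFlow Q r y S τ a b)) := by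
  have haT : a ∈ Icc 0 T := ⟨ha, hab.trans hb⟩
  suffices ∀ d s, s = pieceIndex S τ a + d → s ≤ S → ∀ t ∈ piece T S τ s, a ≤ t →
      Tendsto (fun K : ℕ => ((T / K) ^ d)⁻¹ • gridFlow T P r y K a t) atTop
        (𝓝 (obsFlow Q r y S τ a t)) from
    this _ _ (Nat.add_sub_cancel' (hp.pieceIndex_mono ha hab)).symm (pieceIndex_le b) b
      (hp.mem_piece ⟨ha.trans hab, hb⟩) hab
  intro d
  induction d with
  | zero =>
    rintro s rfl hs t ht hat
    simpa only [pow_zero, inv_one, one_smul] using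
      hp.tendsto_gridFlow_of_mem_piece hP hs hat (hp.mem_piece haT) ht
  | succ d ih =>
    rintro _ rfl hs t ht -
    obtain ⟨s, hsd⟩ : ∃ s, s = pieceIndex S τ a + d := ⟨_, rfl⟩
    rw [← add_assoc, ← hsd] at hs ht
    have hs' : s < S := hs
    set c := max a (τ s)
    have hac : a ≤ c := le_max_left _ _
    have hcτ : c < τ (s + 1) :=
      max_lt (lt_of_pieceIndex_lt hs (by omega)) (hp.lt s hs')
    have hcs : c ∈ piece T S τ s :=
      hp.mem_piece_iff.2 ⟨le_max_right _ _, hcτ.le.trans (hp.mem_Icc hs').2, fun _ => hcτ⟩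
    obtain ⟨hτt, -, -⟩ := hp.mem_piece_iff.1 ht
    have hlim := ((ih s hsd hs'.le c hcs hac).mul
      (hp.tendsto_gridFlow_succ hP (r := r) hs' hcs)).mul
      (hp.tendsto_gridFlow_of_mem_piece hP (r := r) hs hτt (hp.left_mem_piece hs) ht)
    rw [obsFlow, hp.flow_mul_flow ha hac hcτ.le, hp.flow_mul_flow ha (hac.trans hcτ.le) hτt] at hlim
    refine hlim.congr fun K => ?_
    rw [Matrix.smul_mul, Matrix.mul_smul, smul_smul, Matrix.smul_mul,
      gridFlow_mul_gridFlow hp.nonneg K hac hcτ.le,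
      gridFlow_mul_gridFlow hp.nonneg K (hac.trans hcτ.le) hτt, ← mul_inv, pow_succ]

end IsJumpPartition

end DiscreteFlow

section PathSums

variable {ι : Type*}

/-- The weight of the path `x 0, ..., x K`: its initial weight times the weights of its steps. -/
def pathWeight (v : ι → ℝ) (N : ℕ → Matrix ι ι ℝ) (K : ℕ) (x : ℕ → ι) : ℝ :=
  v (x 0) * ∏ l ∈ Finset.range K, N l (x l) (x (l + 1))

/-- A finite path, continued by its last value. -/
def extendPath {E : Type*} {K : ℕ} (x : Fin (K + 1) → E) (k : ℕ) : E := x (Fin.clamp k K)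

theorem extendPath_of_le {E : Type*} {K k : ℕ} (x : Fin (K + 1) → E) (hk : k ≤ K) :
    extendPath x k = x ⟨k, Nat.lt_succ_of_le hk⟩ :=
  congrArg x (Fin.ext (Nat.min_eq_left hk))

theorem extendPath_cons_succ {E : Type*} {K : ℕ} (a : E) (x : Fin (K + 1) → E) (k : ℕ) :
    extendPath (Fin.cons a x : Fin (K + 2) → E) (k + 1) = extendPath x k := by
  rw [extendPath, extendPath, ← Fin.cons_succ (α := fun _ => E) a x (Fin.clamp k K)]
  exact congrArg _ (Fin.ext (Nat.succ_min_succ k K))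

theorem pathWeight_extendPath_cons (v : ι → ℝ) (N : ℕ → Matrix ι ι ℝ) {K : ℕ} (a : ι)
    (x : Fin (K + 1) → ι) :
    pathWeight v N (K + 1) (extendPath (Fin.cons a x : Fin (K + 2) → ι)) =
      v a * N 0 a (extendPath x 0) *
        ∏ l ∈ Finset.range K, N (l + 1) (extendPath x l) (extendPath x (l + 1)) := by
  rw [pathWeight, Finset.prod_range_succ', mul_comm (∏ _ ∈ _, _), ← mul_assoc]
  simp only [extendPath_cons_succ]
  rfl

variable [Fintype ι]

theorem sum_pathWeight_succ_mul (v : ι → ℝ) (N : ℕ → Matrix ι ι ℝ) (K : ℕ) (f : ι → ℝ) (k : ℕ) :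
    ∑ x : Fin (K + 2) → ι, pathWeight v N (K + 1) (extendPath x) * f (extendPath x (k + 1)) =
      ∑ x : Fin (K + 1) → ι,
        pathWeight (v ᵥ* N 0) (fun l => N (l + 1)) K (extendPath x) * f (extendPath x k) := by
  rw [← (Fin.consEquiv fun _ : Fin (K + 2) => ι).sum_comp, Fintype.sum_prod_type, Finset.sum_comm]
  refine Finset.sum_congr rfl fun x _ => ?_
  have hcons (a : ι) : Fin.consEquiv (fun _ : Fin (K + 2) => ι) (a, x) = Fin.cons a x := rfl
  simp only [hcons, pathWeight_extendPath_cons, extendPath_cons_succ]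
  rw [← Finset.sum_mul, ← Finset.sum_mul]
  rfl

theorem stepProd_add_one_add_one {M : Type*} [Monoid M] (N : ℕ → M) (k l : ℕ) :
    stepProd N (k + 1) (l + 1) = stepProd (fun l => N (l + 1)) k l := by
  rw [stepProd, stepProd, ← List.Ico.map_add, List.map_map]
  simp only [Function.comp_def, add_comm]

theorem stepProd_zero_succ {M : Type*} [Monoid M] (N : ℕ → M) (k : ℕ) :
    stepProd N 0 (k + 1) = N 0 * stepProd (fun l => N (l + 1)) 0 k := by
  rw [← stepProd_mul_stepProd N zero_le_one k.succ_pos, ← stepProd_add_one_add_one]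
  congr 1
  exact stepProd_succ_self N 0

variable [DecidableEq ι]

theorem sum_pathWeight (v : ι → ℝ) (N : ℕ → Matrix ι ι ℝ) (K : ℕ) :
    ∑ x : Fin (K + 1) → ι, pathWeight v N K (extendPath x) = v ⬝ᵥ (stepProd N 0 K *ᵥ 1) := by
  induction K generalizing v N with
  | zero =>
    rw [stepProd_self, Matrix.one_mulVec, dotProduct_one,
      ← (Equiv.funUnique (Fin 1) ι).symm.sum_comp]
    simp only [pathWeight, Finset.range_zero, Finset.prod_empty, mul_one]
    rfl
  | succ K ih =>
    have h := sum_pathWeight_succ_mul v N K 1 0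
    simp only [Pi.one_apply, mul_one] at h
    rw [h, ih, stepProd_zero_succ, ← Matrix.mulVec_mulVec, Matrix.dotProduct_mulVec v]

theorem sum_pathWeight_indicator (v : ι → ℝ) (N : ℕ → Matrix ι ι ℝ) {K k : ℕ} (hk : k ≤ K)
    (i : ι) :
    ∑ x : Fin (K + 1) → ι, (if extendPath x k = i then pathWeight v N K (extendPath x) else 0) =
      (v ᵥ* stepProd N 0 k) i * (stepProd N k K *ᵥ 1) i := by
  induction k generalizing v N K with
  | zero =>
    have hw : ∀ x : Fin (K + 1) → ι,
        (if extendPath x 0 = i then pathWeight v N K (extendPath x) else 0) =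
          pathWeight (Pi.single i (v i)) N K (extendPath x) := fun x => by
      split_ifs with h
      · rw [pathWeight, pathWeight, h, Pi.single_eq_same]
      · rw [pathWeight, Pi.single_eq_of_ne h, zero_mul]
    simp only [hw, sum_pathWeight, single_dotProduct, stepProd_self, Matrix.vecMul_one]
  | succ k ih =>
    obtain ⟨K, rfl⟩ := Nat.exists_eq_add_of_le' (k.succ_pos.trans_le hk)
    have h := sum_pathWeight_succ_mul v N K (fun j => if j = i then 1 else 0) k
    simp only [mul_ite, mul_one, mul_zero] at h
    rw [h, ih _ _ (Nat.le_of_succ_le_succ hk), stepProd_zero_succ, stepProd_add_one_add_one,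
      Matrix.vecMul_vecMul]

end PathSums

section Emission

variable {n m : ℕ} {r : Fin n → Fin m → ℝ}

/-- The transition matrix of the observation over a cell in which the hidden state passes from `i`
to `j`, provided that it jumps at most once in the cell. -/
def emissionMatrix (r : Fin n → Fin m → ℝ) (i j : Fin n) : Matrix (Fin m) (Fin m) ℝ :=
  if i = j then 1 else .of fun _ => r j

/-- The conditional probability of the observations `y 0, ..., y K` on a grid given the hidden
states `x 0, ..., x K`, provided that at most one hidden jump happens per cell. -/
def emissionWeight (r : Fin n → Fin m → ℝ) (x : ℕ → Fin n) (K : ℕ) (y : ℕ → Fin m) : ℝ :=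
  pathWeight (r (x 0)) (fun l => emissionMatrix r (x l) (x (l + 1))) K y

theorem emissionWeight_succ (r : Fin n → Fin m → ℝ) (x : ℕ → Fin n) (K : ℕ) (y : ℕ → Fin m) :
    emissionWeight r x (K + 1) y =
      emissionWeight r x K y * emissionMatrix r (x K) (x (K + 1)) (y K) (y (K + 1)) := by
  rw [emissionWeight, pathWeight, Finset.prod_range_succ, ← mul_assoc]
  rfl

theorem emissionMatrix_mulVec_one (hr : ∀ i, ∑ z, r i z = 1) (i j : Fin n) :
    emissionMatrix r i j *ᵥ 1 = 1 := by
  ext z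
  rw [emissionMatrix]
  split_ifs
  · rw [Matrix.one_mulVec]
  · simpa only [Matrix.mulVec, dotProduct_one, Matrix.of_apply, Pi.one_apply] using hr j

theorem stepProd_mulVec_eq {ι : Type*} [Fintype ι] [DecidableEq ι] {N : ℕ → Matrix ι ι ℝ}
    {w : ι → ℝ} {c : ℝ} (h : ∀ l, N l *ᵥ w = c • w) (K : ℕ) : stepProd N 0 K *ᵥ w = c ^ K • w := by
  induction K with
  | zero => rw [stepProd_self, Matrix.one_mulVec, pow_zero, one_smul]
  | succ K ih =>
    rw [← stepProd_mul_stepProd N K.zero_le K.le_succ, stepProd_succ_self, ← Matrix.mulVec_mulVec,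
      h, Matrix.mulVec_smul, ih, smul_smul, pow_succ']

theorem sum_emissionWeight (hr : ∀ i, ∑ z, r i z = 1) (x : ℕ → Fin n) (K : ℕ) :
    ∑ y : Fin (K + 1) → Fin m, emissionWeight r x K (extendPath y) = 1 := by
  simp only [emissionWeight]
  rw [sum_pathWeight, stepProd_mulVec_eq (c := 1) fun l => by
    rw [emissionMatrix_mulVec_one hr, one_smul], one_pow, one_smul, dotProduct_one, hr]

theorem stepMatrix_apply (P : Matrix (Fin n) (Fin n) ℝ) (r : Fin n → Fin m → ℝ) (y z : Fin m)
    (i j : Fin n) : stepMatrix P r y z i j = P i j * emissionMatrix r i j y z := by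
  rw [stepMatrix, emissionMatrix]
  rcases eq_or_ne i j with rfl | hij <;> rcases eq_or_ne y z with rfl | hyz <;>
    simp [heldRate_apply, jumpRate_apply, *]

theorem pathWeight_mul_emissionWeight (P : Matrix (Fin n) (Fin n) ℝ) (r : Fin n → Fin m → ℝ)
    (π₀ : Fin n → ℝ) (K : ℕ) (x : ℕ → Fin n) (y : ℕ → Fin m) :
    pathWeight π₀ (fun _ => P) K x * emissionWeight r x K y =
      pathWeight (π₀ ᵥ* R r (y 0)) (obsStep P r y) K x := by
  rw [emissionWeight, pathWeight, pathWeight, pathWeight, mul_mul_mul_comm,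
    ← Finset.prod_mul_distrib, R, Matrix.vecMul_diagonal]
  simp only [obsStep, stepMatrix_apply]

theorem emissionWeight_eq_zero {x : ℕ → Fin n} {y : ℕ → Fin m} {K k : ℕ} (hk : k < K)
    (hx : x k = x (k + 1)) (hy : y k ≠ y (k + 1)) : emissionWeight r x K y = 0 := by
  rw [emissionWeight, pathWeight, Finset.prod_eq_zero (Finset.mem_range.2 hk), mul_zero]
  rw [emissionMatrix, if_pos hx, Matrix.one_apply_ne hy]

theorem exists_comp_changes_eq {E F : Type*} [DecidableEq E] {x : ℕ → E} {y : ℕ → F} {K : ℕ}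
    (h : ∀ k < K, x k = x (k + 1) → y k = y (k + 1)) :
    ∃ u : ℕ → F, ∀ k ≤ K, u (changes x k) = y k := by
  induction K with
  | zero => exact ⟨fun _ => y 0, fun k hk => by rw [Nat.le_zero.1 hk]⟩
  | succ K ih =>
    obtain ⟨u, hu⟩ := ih fun k hk => h k (hk.trans K.lt_succ_self)
    by_cases hx : x K = x (K + 1)
    · refine ⟨u, fun k hk => ?_⟩
      rcases Nat.le_succ_iff.1 hk with hk | rfl
      · exact hu k hk
      · rw [changes_succ, if_pos hx, add_zero, hu K le_rfl, h K K.lt_succ_self hx]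
    · refine ⟨Function.update u (changes x (K + 1)) (y (K + 1)), fun k hk => ?_⟩
      rcases Nat.le_succ_iff.1 hk with hk | rfl
      · have hlt := (changes_mono x hk).trans_lt (changes_lt_of_ne K.le_succ hx)
        rw [Function.update_of_ne hlt.ne, hu k hk]
      · rw [Function.update_self]

theorem emissionWeight_eq_prod {x : ℕ → Fin n} {y : ℕ → Fin m} {K : ℕ} {u : ℕ → Fin n}
    {w : ℕ → Fin m} (hu : ∀ k ≤ K, u (changes x k) = x k) (hw : ∀ k ≤ K, w (changes x k) = y k) :
    emissionWeight r x K y = ∏ s ∈ Finset.range (changes x K + 1), r (u s) (w s) := by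
  induction K with
  | zero =>
    rw [changes_zero, zero_add, Finset.prod_range_one, emissionWeight, pathWeight,
      Finset.prod_range_zero, mul_one, ← hu 0 le_rfl, ← hw 0 le_rfl, changes_zero]
  | succ K ih =>
    have hK := K.le_succ
    rw [emissionWeight_succ, ih (fun k hk => hu k (hk.trans hK)) fun k hk => hw k (hk.trans hK),
      emissionMatrix]
    have huK := hu (K + 1) le_rfl
    have hwK := hw (K + 1) le_rfl
    rw [changes_succ] at huK hwK ⊢
    split_ifs at huK hwK ⊢ with hx
    · rw [add_zero, ← hw K hK, ← hwK, add_zero, Matrix.one_apply_eq, mul_one]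
    · rw [Finset.prod_range_succ _ (changes x K + 1), huK, hwK, Matrix.of_apply]

end Emission

section Skeleton

variable {Ω E : Type*} {n m : ℕ} {T : ℝ} {Q : Matrix (Fin n) (Fin n) ℝ} {r : Fin n → Fin m → ℝ}
  {π₀ : Fin n → ℝ} {X : ℝ → Ω → Fin n} {Y : ℝ → Ω → Fin m} {P : ℝ → Matrix (Fin n) (Fin n) ℝ}

theorem measurable_pathSigma {Z : ℝ → Ω → Fin m} {t u : ℝ} (hu : u ∈ Icc 0 t) :
    Measurable[pathSigma Z t] (Z u) :=
  measurable_iff_comap_le.2 (le_iSup₂_of_le u hu le_rfl)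

/-- The event that the process `Z` takes the values `z 0, ..., z j` at the first `j + 1` points of
the grid with `K` cells. -/
def gridCylinder (T : ℝ) (K j : ℕ) (Z : ℝ → Ω → E) (z : ℕ → E) : Set Ω :=
  {ω | ∀ k ≤ j, Z (grid T K k) ω = z k}

theorem gridCylinder_succ (T : ℝ) (K j : ℕ) (Z : ℝ → Ω → E) (z : ℕ → E) :
    gridCylinder T K (j + 1) Z z =
      gridCylinder T K j Z z ∩ {ω | Z (grid T K (j + 1)) ω = z (j + 1)} := by
  ext ω
  refine ⟨fun h => ⟨fun k hk => h k (hk.trans j.le_succ), h _ le_rfl⟩, fun h k hk => ?_⟩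
  rcases Nat.le_succ_iff.1 hk with hk | rfl
  · exact h.1 k hk
  · exact h.2

/-- The event that the hidden path jumps at most once in each cell of the grid with `K` cells, so
that the grid sees all its jumps. -/
def fineSet (T : ℝ) (X : ℝ → Ω → E) [DecidableEq E] (K : ℕ) : Set Ω :=
  {ω | ∃ τ, IsJumpPartition T (fun t => X t ω) (changes (fun l => X (grid T K l) ω) K) τ}

theorem eventually_mem_fineSet [DecidableEq E] {X : ℝ → Ω → E} {ω : Ω} {S : ℕ} {τ : ℕ → ℝ}
    (hp : IsJumpPartition T (fun t => X t ω) S τ) : ∀ᶠ K in atTop, ω ∈ fineSet T X K := by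
  filter_upwards [hp.eventually_changes_eq] with K hK
  exact ⟨τ, hK.symm ▸ hp⟩

variable [mΩ : MeasurableSpace Ω] {μ : Measure Ω}

theorem pathSigma_le {Z : ℝ → Ω → Fin m} {t : ℝ} (h : ∀ u ∈ Icc 0 t, Measurable (Z u)) :
    pathSigma Z t ≤ mΩ :=
  iSup₂_le fun u hu => (h u hu).comap_le

/-- The Markov property with transition matrices `P`. -/
def IsMarkov (μ : Measure Ω) (T : ℝ) (P : ℝ → Matrix (Fin n) (Fin n) ℝ) (X : ℝ → Ω → Fin n) :
    Prop :=
  ∀ s t, 0 ≤ s → s ≤ t → t ≤ T → ∀ A, MeasurableSet[pathSigma X s] A → ∀ i j,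
    μ.real (A ∩ {ω | X s ω = i} ∩ {ω | X t ω = j}) =
      μ.real (A ∩ {ω | X s ω = i}) * P (t - s) i j

theorem IsJumpProcess.exists_hasGenerator (h : IsJumpProcess μ T Q π₀ X) :
    ∃ P, HasGenerator P Q ∧ IsMarkov μ T P X := by
  obtain ⟨P, hP, hM, hlim⟩ := h.markov
  refine ⟨Function.update P 0 1, ⟨Function.update_self 0 1 P, fun u hu => ?_, fun i j hij => ?_,
    h.diag⟩, fun s t hs hst ht A hA i j => ?_⟩
  · rcases eq_or_ne u 0 with rfl | hu0
    · exact Function.update_self (0 : ℝ) _ P ▸ one_mem _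
    · exact Function.update_of_ne hu0 _ P ▸ hP u hu
  · refine (hlim i j hij).congr' ?_
    filter_upwards [self_mem_nhdsWithin] with u hu
    rw [Function.update_of_ne (ne_of_gt hu)]
  · rcases hst.eq_or_lt with rfl | hlt
    · rw [sub_self, Function.update_self, inter_assoc]
      rcases eq_or_ne i j with rfl | hij
      · rw [inter_self, Matrix.one_apply_eq, mul_one]
      · have hdisj : {ω | X s ω = i} ∩ {ω | X s ω = j} = ∅ :=
          eq_empty_of_forall_notMem fun ω hω => hij (hω.1.symm.trans hω.2)
        rw [hdisj, inter_empty, measureReal_empty, Matrix.one_apply_ne hij, mul_zero]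
    · rw [Function.update_of_ne (sub_pos.2 hlt).ne']
      exact hM s t hs hst ht A hA i j

theorem measurableSet_gridCylinder {Z : ℝ → Ω → Fin m} {K j : ℕ}
    (h : ∀ k ≤ j, Measurable (Z (grid T K k))) (z : ℕ → Fin m) :
    MeasurableSet (gridCylinder T K j Z z) := by
  simp only [gridCylinder, ofPred_forall]
  exact .iInter fun k => .iInter fun hk => h k hk (measurableSet_singleton _)

theorem IsMarkov.measureReal_gridCylinder (hM : IsMarkov μ T P X) (hT : 0 ≤ T) {K j : ℕ}
    (hj : j ≤ K) (x : ℕ → Fin n) :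
    μ.real (gridCylinder T K j X x) =
      pathWeight (fun i => μ.real {ω | X 0 ω = i}) (fun _ => P (T / K)) j x := by
  induction j with
  | zero => simp [gridCylinder, pathWeight]
  | succ j ih =>
    have hjK := j.le_succ.trans hj
    have hA : MeasurableSet[pathSigma X (grid T K j)] (gridCylinder T K j X x) :=
      measurableSet_gridCylinder (mΩ := pathSigma X (grid T K j)) (fun k hk =>
        measurable_pathSigma ⟨(grid_mem hT (hk.trans hjK)).1, grid_mono hT hk⟩) x
    have hstep := hM (grid T K j) (grid T K (j + 1)) (grid_mem hT hjK).1 (grid_mono hT j.le_succ)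
      (grid_mem hT hj).2 _ hA (x j) (x (j + 1))
    have hlast : gridCylinder T K j X x ∩ {ω | X (grid T K j) ω = x j} = gridCylinder T K j X x :=
      inter_eq_left.2 fun ω hω => hω j le_rfl
    rw [hlast, ← gridCylinder_succ, ih hjK, grid_succ, add_sub_cancel_left] at hstep
    rw [hstep, pathWeight, pathWeight, Finset.prod_range_succ, mul_assoc]

theorem measurable_changes {Z : ℕ → Ω → Fin m} {K : ℕ} (h : ∀ l ≤ K, Measurable (Z l)) :
    Measurable fun ω => changes (fun l => Z l ω) K :=
  Finset.measurable_fun_sum _ fun l hl => by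
    have hl := Finset.mem_range.1 hl
    exact .ite (measurableSet_eq_fun (h l hl.le) (h (l + 1) hl)) measurable_const measurable_const

theorem measurableSet_fineSet (hT : 0 ≤ T) (hX : ∀ t ∈ Icc 0 T, Measurable (X t))
    (hpath : ∀ ω, ∃ S τ, IsJumpPartition T (fun t => X t ω) S τ) (K : ℕ) :
    MeasurableSet (fineSet T X K) := by
  have hm : ∀ L, Measurable fun ω => changes (fun l => X (grid T L l) ω) L := fun L =>
    measurable_changes fun l hl => hX _ (grid_mem hT hl)
  refine measurableSet_of_tendsto_indicator atTop (As := fun L => {ω |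
    changes (fun l => X (grid T L l) ω) L = changes (fun l => X (grid T K l) ω) K})
    (fun L => measurableSet_eq_fun (hm L) (hm K)) fun ω => ?_
  obtain ⟨S, τ, hp⟩ := hpath ω
  filter_upwards [hp.eventually_changes_eq] with L hL
  rw [hL]
  refine ⟨fun h => ⟨τ, h ▸ hp⟩, fun ⟨τ', hp'⟩ => ?_⟩
  obtain ⟨M, hM, hM'⟩ := (hp.eventually_changes_eq.and hp'.eventually_changes_eq).exists
  exact hM.symm.trans hM'

theorem IsJumpProcess.tendsto_measureReal_compl_fineSet [IsFiniteMeasure μ]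
    (hX : IsJumpProcess μ T Q π₀ X) (hT : 0 ≤ T) :
    Tendsto (fun K => μ.real (fineSet T X K)ᶜ) atTop (𝓝 0) := by
  rw [← measureReal_empty (μ := μ)]
  refine (ENNReal.tendsto_toReal (measure_ne_top μ ∅)).comp
    (tendsto_measure_of_tendsto_indicator_of_isFiniteMeasure atTop μ
      (fun K => (measurableSet_fineSet hT hX.measurable hX.path K).compl) fun ω => ?_)
  obtain ⟨S, τ, hp⟩ := hX.path ω
  filter_upwards [eventually_mem_fineSet hp] with K hK
  exact ⟨fun h => h hK, fun h => h.elim⟩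

end Skeleton

section JointLaw

variable {Ω : Type*} {n m : ℕ} {T : ℝ} {Q : Matrix (Fin n) (Fin n) ℝ} {r : Fin n → Fin m → ℝ}
  {π₀ : Fin n → ℝ} {X : ℝ → Ω → Fin n} {Y : ℝ → Ω → Fin m} {P : ℝ → Matrix (Fin n) (Fin n) ℝ}
  {K : ℕ}

theorem changes_congr {E : Type*} [DecidableEq E] {x x' : ℕ → E} {k : ℕ}
    (h : ∀ l ≤ k, x l = x' l) : changes x k = changes x' k :=
  Finset.sum_congr rfl fun l hl => by
    have hl := Finset.mem_range.1 hl
    rw [h l hl.le, h (l + 1) hl]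

theorem changes_eq_of_mem_gridCylinder {E : Type*} [DecidableEq E] {X : ℝ → Ω → E} {x : ℕ → E}
    {ω : Ω} (hω : ω ∈ gridCylinder T K K X x) {k : ℕ} (hk : k ≤ K) :
    changes (fun l => X (grid T K l) ω) k = changes x k :=
  changes_congr fun l hl => hω l (hl.trans hk)

theorem apply_jump_of_mem_gridCylinder {E F : Type*} [DecidableEq E] {X : ℝ → Ω → E} {x : ℕ → E}
    {Z : ℝ → Ω → F} {ω : Ω} {τ : ℕ → ℝ} (hω : ω ∈ gridCylinder T K K X x)
    (hp : IsJumpPartition T (fun t => X t ω) (changes x K) τ)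
    (hZ : ConstOnPieces T (fun t => Z t ω) (changes x K) τ) {k : ℕ} (hk : k ≤ K) :
    Z (τ (changes x k)) ω = Z (grid T K k) ω := by
  rw [← changes_eq_of_mem_gridCylinder hω hk,
    hp.changes_eq_pieceIndex (changes_eq_of_mem_gridCylinder hω le_rfl) hk]
  exact (hZ _ (pieceIndex_le _) _ (hp.mem_piece (grid_mem hp.nonneg hk))).symm

theorem gridCylinder_inter_fineSet_inter {E F : Type*} [DecidableEq E] {X : ℝ → Ω → E}
    {Z : ℝ → Ω → F} {x u : ℕ → E} {z w : ℕ → F}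
    (hZ : ∀ ω τ, IsJumpPartition T (fun t => X t ω) (changes x K) τ →
      ConstOnPieces T (fun t => Z t ω) (changes x K) τ)
    (hu : ∀ k ≤ K, u (changes x k) = x k) (hw : ∀ k ≤ K, w (changes x k) = z k) :
    gridCylinder T K K X x ∩ fineSet T X K ∩ gridCylinder T K K Z z =
      gridCylinder T K K X x ∩ {ω | ∃ τ, IsJumpPartition T (fun t => X t ω) (changes x K) τ ∧
        ∀ s ≤ changes x K, X (τ s) ω = u s ∧ Z (τ s) ω = w s} := by
  ext ω
  rw [inter_assoc]
  refine and_congr_right fun hω => ⟨fun ⟨⟨τ, hp⟩, hz⟩ => ?_, fun ⟨τ, hp, hz⟩ => ⟨⟨τ, ?_⟩, ?_⟩⟩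
  · rw [changes_eq_of_mem_gridCylinder hω le_rfl] at hp
    refine ⟨τ, hp, fun s hs => ?_⟩
    obtain ⟨k, hk, rfl⟩ := exists_changes_eq x hs
    rw [apply_jump_of_mem_gridCylinder hω hp hp.const hk,
      apply_jump_of_mem_gridCylinder hω hp (hZ ω τ hp) hk, hu k hk, hw k hk]
    exact ⟨hω k hk, hz k hk⟩
  · exact (changes_eq_of_mem_gridCylinder hω le_rfl).symm ▸ hp
  · intro k hk
    rw [← apply_jump_of_mem_gridCylinder hω hp (hZ ω τ hp) hk, (hz _ (changes_mono x hk)).2,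
      hw k hk]

variable [MeasurableSpace Ω] {μ : Measure Ω}

theorem IsCTHMM.measureReal_inter_gridCylinder (h : IsCTHMM μ T Q r π₀ X Y) (hT : 0 ≤ T)
    (x : ℕ → Fin n) (y : ℕ → Fin m) :
    μ.real (gridCylinder T K K X x ∩ fineSet T X K ∩ gridCylinder T K K Y y) =
      μ.real (gridCylinder T K K X x ∩ fineSet T X K) * emissionWeight r x K y := by
  have hY : ∀ ω τ, IsJumpPartition T (fun t => X t ω) (changes x K) τ →
    ConstOnPieces T (fun t => Y t ω) (changes x K) τ := fun ω τ => h.held ω _ τ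
  by_cases hxy : ∀ k < K, x k = x (k + 1) → y k = y (k + 1)
  · obtain ⟨u, hu⟩ := exists_comp_changes_eq (x := x) (y := x) (K := K) fun k _ hx => hx
    obtain ⟨w, hw⟩ := exists_comp_changes_eq hxy
    have hA : MeasurableSet[pathSigma X T] (gridCylinder T K K X x) :=
      measurableSet_gridCylinder (mΩ := pathSigma X T)
        (fun k hk => measurable_pathSigma (grid_mem hT hk)) x
    have hXF := gridCylinder_inter_fineSet_inter (T := T) (Z := X) (fun _ _ hp => hp.const) hu hu
    rw [inter_right_comm, inter_self] at hXF
    simp only [and_self] at hXF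
    rw [gridCylinder_inter_fineSet_inter hY hu hw, hXF, emissionWeight_eq_prod hu hw]
    exact h.observe _ hA (changes x K) u w
  · push Not at hxy
    obtain ⟨k, hk, hx, hy⟩ := hxy
    rw [emissionWeight_eq_zero hk hx hy, mul_zero, ← measureReal_empty (μ := μ)]
    refine congrArg _ (eq_empty_of_forall_notMem ?_)
    rintro ω ⟨⟨hω, τ, hp⟩, hyω⟩
    rw [changes_eq_of_mem_gridCylinder hω le_rfl] at hp
    have hch : changes x (k + 1) = changes x k := by rw [changes_succ, if_pos hx, add_zero]
    apply hy
    rw [← hyω k hk.le, ← hyω (k + 1) hk,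
      ← apply_jump_of_mem_gridCylinder hω hp (hY ω τ hp) hk.le,
      ← apply_jump_of_mem_gridCylinder hω hp (hY ω τ hp) hk, hch]

end JointLaw

section GridLaw

variable {Ω : Type*} {n m : ℕ} {T : ℝ} {Q : Matrix (Fin n) (Fin n) ℝ} {r : Fin n → Fin m → ℝ}
  {π₀ : Fin n → ℝ} {X : ℝ → Ω → Fin n} {Y : ℝ → Ω → Fin m} {P : ℝ → Matrix (Fin n) (Fin n) ℝ}
  {K : ℕ}

/-- The values of a process on the grid with `K` cells. -/
def gridPath {E : Type*} (T : ℝ) (K : ℕ) (Z : ℝ → Ω → E) (ω : Ω) : Fin (K + 1) → E :=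
  fun k => Z (grid T K k) ω

theorem extendPath_gridPath {E : Type*} (T : ℝ) (Z : ℝ → Ω → E) (ω : Ω) {k : ℕ} (hk : k ≤ K) :
    extendPath (gridPath T K Z ω) k = Z (grid T K k) ω :=
  extendPath_of_le _ hk

theorem gridPath_preimage_singleton {E : Type*} (T : ℝ) (Z : ℝ → Ω → E) (z : Fin (K + 1) → E) :
    gridPath T K Z ⁻¹' {z} = gridCylinder T K K Z (extendPath z) := by
  ext ω
  refine ⟨?_, fun h => funext fun k => ?_⟩
  · rintro rfl k hk
    exact (extendPath_gridPath T Z ω hk).symm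
  · exact (h k (Nat.le_of_lt_succ k.2)).trans (extendPath_of_le z (Nat.le_of_lt_succ k.2))

/-- The weight of the hidden states `x 0, ..., x K` together with the observations `y 0, ..., y K`
in the discrete-time model with transition matrix `P`. -/
def jointWeight (P : Matrix (Fin n) (Fin n) ℝ) (r : Fin n → Fin m → ℝ) (π₀ : Fin n → ℝ) (K : ℕ)
    (x : ℕ → Fin n) (y : ℕ → Fin m) : ℝ :=
  pathWeight (π₀ ᵥ* R r (y 0)) (obsStep P r y) K x

theorem emissionMatrix_nonneg (hr : ∀ i z, 0 ≤ r i z) (i j : Fin n) (y z : Fin m) :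
    0 ≤ emissionMatrix r i j y z := by
  rw [emissionMatrix]
  split_ifs
  · rw [Matrix.one_apply]
    positivity
  · exact hr j z

theorem emissionWeight_nonneg (hr : ∀ i z, 0 ≤ r i z) (x : ℕ → Fin n) (K : ℕ) (y : ℕ → Fin m) :
    0 ≤ emissionWeight r x K y :=
  mul_nonneg (hr _ _) (Finset.prod_nonneg fun _ _ => emissionMatrix_nonneg hr _ _ _ _)

variable [MeasurableSpace Ω] {μ : Measure Ω}

theorem measurable_gridPath {Z : ℝ → Ω → Fin m} (hT : 0 ≤ T) (h : ∀ t ∈ Icc 0 T, Measurable (Z t))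
    (K : ℕ) : Measurable (gridPath T K Z) :=
  measurable_pi_lambda _ fun k => h _ (grid_mem hT (Nat.le_of_lt_succ k.2))

variable [IsFiniteMeasure μ] {ι : Type*} [Fintype ι] [MeasurableSpace ι]
  [MeasurableSingletonClass ι] {f : Ω → ι}

theorem sum_measureReal_inter_preimage_singleton (hf : Measurable f) (C : Set Ω) :
    ∑ i, μ.real (C ∩ f ⁻¹' {i}) = μ.real C := by
  have h := sum_measureReal_preimage_singleton (μ := μ.restrict C) Finset.univ
    fun i _ => hf (measurableSet_singleton i)
  simpa only [measureReal_restrict_apply (hf (measurableSet_singleton _)), inter_comm _ C,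
    Finset.coe_univ, preimage_univ, measureReal_restrict_apply_univ] using h

theorem integral_comp_eq_sum (hf : Measurable f) (g : ι → ℝ) :
    ∫ ω, g (f ω) ∂μ = ∑ i, μ.real (f ⁻¹' {i}) * g i := by
  rw [← integral_map hf.aemeasurable (measurable_of_finite g).aestronglyMeasurable,
    integral_fintype .of_finite]
  simp only [map_measureReal_apply hf (measurableSet_singleton _), smul_eq_mul]

theorem IsCTHMM.measureReal_preimage_sub_jointWeight (h : IsCTHMM μ T Q r π₀ X Y)
    (hM : IsMarkov μ T P X) (hT : 0 ≤ T) (x : Fin (K + 1) → Fin n) (y : Fin (K + 1) → Fin m) :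
    μ.real (gridPath T K X ⁻¹' {x} ∩ gridPath T K Y ⁻¹' {y}) -
        jointWeight (P (T / K)) r π₀ K (extendPath x) (extendPath y) =
      μ.real ((fineSet T X K)ᶜ ∩ gridPath T K X ⁻¹' {x} ∩ gridPath T K Y ⁻¹' {y}) -
        μ.real ((fineSet T X K)ᶜ ∩ gridPath T K X ⁻¹' {x}) *
          emissionWeight r (extendPath x) K (extendPath y) := by
  have hF := measurableSet_fineSet hT h.hidden.measurable h.hidden.path K
  have hsplit (C : Set Ω) : μ.real C = μ.real (C ∩ fineSet T X K) +
      μ.real ((fineSet T X K)ᶜ ∩ C) := by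
    rw [inter_comm _ C, ← sdiff_eq, measureReal_inter_add_sdiff hF]
  have hweight : jointWeight (P (T / K)) r π₀ K (extendPath x) (extendPath y) =
      μ.real (gridPath T K X ⁻¹' {x}) * emissionWeight r (extendPath x) K (extendPath y) := by
    rw [jointWeight, ← pathWeight_mul_emissionWeight, gridPath_preimage_singleton,
      hM.measureReal_gridCylinder hT le_rfl, funext h.hidden.init]
  have hfine := h.measureReal_inter_gridCylinder hT (K := K) (extendPath x) (extendPath y)
  rw [← gridPath_preimage_singleton, ← gridPath_preimage_singleton, inter_right_comm] at hfine
  rw [hweight, hsplit (_ ∩ _), hfine, hsplit (gridPath T K X ⁻¹' {x}), inter_assoc]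
  ring

theorem IsCTHMM.abs_integral_sub_sum_le (h : IsCTHMM μ T Q r π₀ X Y) (hM : IsMarkov μ T P X)
    (hT : 0 ≤ T) {f : (Fin (K + 1) → Fin n) → (Fin (K + 1) → Fin m) → ℝ}
    (hf : ∀ x y, |f x y| ≤ 1) :
    |∫ ω, f (gridPath T K X ω) (gridPath T K Y ω) ∂μ -
        ∑ x, ∑ y, jointWeight (P (T / K)) r π₀ K (extendPath x) (extendPath y) * f x y| ≤
      2 * μ.real (fineSet T X K)ᶜ := by
  have hX := measurable_gridPath hT h.hidden.measurable K
  have hY := measurable_gridPath hT h.measurable K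
  set p := fun (x : Fin (K + 1) → Fin n) (y : Fin (K + 1) → Fin m) =>
    μ.real ((fineSet T X K)ᶜ ∩ gridPath T K X ⁻¹' {x} ∩ gridPath T K Y ⁻¹' {y})
  set q := fun (x : Fin (K + 1) → Fin n) (y : Fin (K + 1) → Fin m) =>
    μ.real ((fineSet T X K)ᶜ ∩ gridPath T K X ⁻¹' {x}) *
      emissionWeight r (extendPath x) K (extendPath y)
  have hp : ∑ x, ∑ y, p x y = μ.real (fineSet T X K)ᶜ := by
    simp only [p, sum_measureReal_inter_preimage_singleton hY,
      sum_measureReal_inter_preimage_singleton hX]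
  have hq : ∑ x, ∑ y, q x y = μ.real (fineSet T X K)ᶜ := by
    simp only [q, ← Finset.mul_sum, sum_emissionWeight fun i => (h.emission i).2, mul_one,
      sum_measureReal_inter_preimage_singleton hX]
  have hq₀ (x y) : 0 ≤ q x y :=
    mul_nonneg measureReal_nonneg (emissionWeight_nonneg (fun i => (h.emission i).1) _ _ _)
  have hterm (x y) : |(p x y - q x y) * f x y| ≤ p x y + q x y := by
    rw [abs_mul]
    refine (mul_le_of_le_one_right (abs_nonneg _) (hf x y)).trans ((abs_sub _ _).trans ?_)
    rw [abs_of_nonneg (hq₀ x y), abs_of_nonneg measureReal_nonneg]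
  have hdiff : ∫ ω, f (gridPath T K X ω) (gridPath T K Y ω) ∂μ -
      ∑ x, ∑ y, jointWeight (P (T / K)) r π₀ K (extendPath x) (extendPath y) * f x y =
        ∑ x, ∑ y, (p x y - q x y) * f x y := by
    rw [integral_comp_eq_sum (hX.prodMk hY) fun z => f z.1 z.2, Fintype.sum_prod_type]
    simp only [← Finset.sum_sub_distrib, ← sub_mul, ← singleton_prod_singleton, mk_preimage_prod,
      h.measureReal_preimage_sub_jointWeight hM hT, p, q]
  calc _ ≤ ∑ x, ∑ y, (p x y + q x y) := by
        rw [hdiff]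
        refine (Finset.abs_sum_le_sum_abs _ _).trans (Finset.sum_le_sum fun x _ => ?_)
        exact (Finset.abs_sum_le_sum_abs _ _).trans (Finset.sum_le_sum fun y _ => hterm x y)
    _ = 2 * μ.real (fineSet T X K)ᶜ := by
        simp only [Finset.sum_add_distrib, hp, hq, two_mul]

end GridLaw

section Posterior

variable {n m : ℕ} {P : Matrix (Fin n) (Fin n) ℝ} {r : Fin n → Fin m → ℝ} {π₀ : Fin n → ℝ}
  {K k : ℕ} {y y' : ℕ → Fin m}

theorem jointWeight_congr (h : ∀ l ≤ K, y l = y' l) (x : ℕ → Fin n) :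
    jointWeight P r π₀ K x y = jointWeight P r π₀ K x y' := by
  simp only [jointWeight, pathWeight, obsStep, h 0 K.zero_le]
  congr 1
  refine Finset.prod_congr rfl fun l hl => ?_
  rw [h l (Finset.mem_range.1 hl).le, h (l + 1) (Finset.mem_range.1 hl)]

theorem jointWeight_nonneg (hP : ∀ i j, 0 ≤ P i j) (hr : ∀ i z, 0 ≤ r i z) (hπ : ∀ i, 0 ≤ π₀ i)
    (x : ℕ → Fin n) : 0 ≤ jointWeight P r π₀ K x y := by
  rw [jointWeight, ← pathWeight_mul_emissionWeight]
  exact mul_nonneg (mul_nonneg (hπ _) (Finset.prod_nonneg fun _ _ => hP _ _))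
    (emissionWeight_nonneg hr x K y)

/-- The weight of the observations `y 0, ..., y K` in the discrete-time model with transition
matrix `P`. -/
def likelihood (P : Matrix (Fin n) (Fin n) ℝ) (r : Fin n → Fin m → ℝ) (π₀ : Fin n → ℝ) (K : ℕ)
    (y : ℕ → Fin m) : ℝ :=
  ∑ x : Fin (K + 1) → Fin n, jointWeight P r π₀ K (extendPath x) y

/-- The conditional probability, in the discrete-time model with transition matrix `P`, that the
`k`-th hidden state is `i` given the observations `y 0, ..., y K`; it is `0` if these have
likelihood `0`. -/
def posterior (P : Matrix (Fin n) (Fin n) ℝ) (r : Fin n → Fin m → ℝ) (π₀ : Fin n → ℝ) (K : ℕ)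
    (y : ℕ → Fin m) (k : ℕ) (i : Fin n) : ℝ :=
  (∑ x : Fin (K + 1) → Fin n, if extendPath x k = i then jointWeight P r π₀ K (extendPath x) y
    else 0) / likelihood P r π₀ K y

theorem likelihood_congr (h : ∀ l ≤ K, y l = y' l) :
    likelihood P r π₀ K y = likelihood P r π₀ K y' :=
  Finset.sum_congr rfl fun _ _ => jointWeight_congr h _

theorem posterior_congr (h : ∀ l ≤ K, y l = y' l) (k : ℕ) (i : Fin n) :
    posterior P r π₀ K y k i = posterior P r π₀ K y' k i := by
  simp only [posterior, jointWeight_congr h, likelihood_congr h]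

theorem likelihood_eq_dotProduct (P : Matrix (Fin n) (Fin n) ℝ) (r : Fin n → Fin m → ℝ)
    (π₀ : Fin n → ℝ) (K : ℕ) (y : ℕ → Fin m) :
    likelihood P r π₀ K y = (π₀ ᵥ* R r (y 0)) ⬝ᵥ (stepProd (obsStep P r y) 0 K *ᵥ 1) :=
  sum_pathWeight _ _ _

theorem posterior_eq_mul_div_likelihood (hk : k ≤ K) (y : ℕ → Fin m) (i : Fin n) :
    posterior P r π₀ K y k i =
      (π₀ ᵥ* R r (y 0) ᵥ* stepProd (obsStep P r y) 0 k) i *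
        (stepProd (obsStep P r y) k K *ᵥ 1) i / likelihood P r π₀ K y := by
  rw [← sum_pathWeight_indicator _ _ hk]
  rfl

theorem posterior_mem_Icc (hP : ∀ i j, 0 ≤ P i j) (hr : ∀ i z, 0 ≤ r i z) (hπ : ∀ i, 0 ≤ π₀ i)
    (y : ℕ → Fin m) (k : ℕ) (i : Fin n) : posterior P r π₀ K y k i ∈ Icc 0 1 := by
  have hw (x : Fin (K + 1) → Fin n) := jointWeight_nonneg (K := K) (y := y) hP hr hπ (extendPath x)
  refine ⟨div_nonneg (Finset.sum_nonneg fun x _ => ?_) (Finset.sum_nonneg fun x _ => hw x),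
    div_le_one_of_le₀ (Finset.sum_le_sum fun x _ => ?_) (Finset.sum_nonneg fun x _ => hw x)⟩
  · exact ite_nonneg (hw x) le_rfl
  · split_ifs
    exacts [le_rfl, hw x]

theorem sum_jointWeight_mul_indicator_sub_posterior (hP : ∀ i j, 0 ≤ P i j)
    (hr : ∀ i z, 0 ≤ r i z) (hπ : ∀ i, 0 ≤ π₀ i) (y : ℕ → Fin m) (k : ℕ) (i : Fin n) :
    ∑ x : Fin (K + 1) → Fin n, jointWeight P r π₀ K (extendPath x) y *
      ((if extendPath x k = i then 1 else 0) - posterior P r π₀ K y k i) = 0 := by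
  have hw (x : Fin (K + 1) → Fin n) := jointWeight_nonneg (K := K) (y := y) hP hr hπ (extendPath x)
  simp only [mul_sub, mul_ite, mul_one, mul_zero, Finset.sum_sub_distrib, ← Finset.sum_mul]
  rw [sub_eq_zero, ← likelihood, posterior, mul_div_cancel_of_imp']
  intro h
  have hzero := (Finset.sum_eq_zero_iff_of_nonneg fun x _ => hw x).1 h
  exact Finset.sum_eq_zero fun x hx => by rw [hzero x hx, ite_self]

end Posterior

section PosteriorLimit

variable {n m : ℕ} {T : ℝ} {y : ℝ → Fin m} {S : ℕ} {τ : ℕ → ℝ} {Q : Matrix (Fin n) (Fin n) ℝ}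
  {P : ℝ → Matrix (Fin n) (Fin n) ℝ} {r : Fin n → Fin m → ℝ} {π₀ : Fin n → ℝ}

theorem HasGenerator.gridFlow_last (hP : HasGenerator P Q) (hT : 0 ≤ T) (y : ℝ → Fin m) (K : ℕ)
    (t : ℝ) : gridFlow T P r y K t T = stepProd (gridStep T P r y K) (gridCeil T K t) K := by
  rcases hT.eq_or_lt with rfl | hT
  · have hstep (l : ℕ) : gridStep 0 P r y K l = 1 := by
      simp only [gridStep, obsStep, grid, zero_div, mul_zero, stepMatrix, if_true, hP.zero]
      ext i j
      rw [heldRate_apply, Matrix.one_apply]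
      aesop
    simp only [gridFlow, stepProd_eq_pow fun l _ _ => hstep l, one_pow]
  · rw [gridFlow, gridCeil_self hT]

namespace IsJumpPartition

theorem eventually_mesh_pow_pos (hp : IsJumpPartition T y S τ) :
    ∀ᶠ K : ℕ in atTop, 0 < (T / K) ^ S := by
  rcases S.eq_zero_or_pos with rfl | hS
  · simp only [pow_zero, zero_lt_one, eventually_true]
  · have hT : 0 < T := (hp.zero ▸ hp.lt 0 hS).trans_le (hp.mem_Icc hS).2
    filter_upwards [eventually_gt_atTop 0] with K hK
    positivity

theorem tendsto_vecMul_gridFlow (hp : IsJumpPartition T y S τ) (hP : HasGenerator P Q) {t : ℝ}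
    (ht : t ∈ Icc 0 T) :
    Tendsto (fun K : ℕ => ((T / K) ^ pieceIndex S τ t)⁻¹ •
      (π₀ ᵥ* R r (y 0) ᵥ* gridFlow T P r y K 0 t)) atTop (𝓝 (forward Q r π₀ y S τ t)) := by
  have h := hp.tendsto_gridFlow (r := r) hP le_rfl ht.1 ht.2
  rw [hp.pieceIndex_zero, Nat.sub_zero] at h
  have hcont : Continuous fun A : Matrix (Fin n) (Fin n) ℝ => π₀ ᵥ* R r (y 0) ᵥ* A :=
    continuous_const.matrix_vecMul continuous_id
  simpa only [Function.comp_def, forward, Matrix.vecMul_smul] using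
    (hcont.tendsto _).comp h

theorem tendsto_gridFlow_mulVec_one (hp : IsJumpPartition T y S τ) (hP : HasGenerator P Q) {t : ℝ}
    (ht : t ∈ Icc 0 T) :
    Tendsto (fun K : ℕ => ((T / K) ^ (S - pieceIndex S τ t))⁻¹ • (gridFlow T P r y K t T *ᵥ 1))
      atTop (𝓝 (backward T Q r y S τ t)) := by
  have h := hp.tendsto_gridFlow (r := r) hP ht.1 ht.2 le_rfl
  rw [hp.pieceIndex_last] at h
  have hcont : Continuous fun A : Matrix (Fin n) (Fin n) ℝ => A *ᵥ (1 : Fin n → ℝ) :=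
    continuous_id.matrix_mulVec continuous_const
  simpa only [Function.comp_def, backward, Matrix.smul_mulVec] using
    (hcont.tendsto _).comp h

theorem tendsto_likelihood (hp : IsJumpPartition T y S τ) (hP : HasGenerator P Q) :
    Tendsto (fun K : ℕ => ((T / K) ^ S)⁻¹ *
      likelihood (P (T / K)) r π₀ K fun l => y (grid T K l)) atTop
      (𝓝 (forward Q r π₀ y S τ 0 ⬝ᵥ backward T Q r y S τ 0)) := by
  have h := hp.tendsto_gridFlow_mulVec_one (r := r) hP ⟨le_rfl, hp.nonneg⟩
  rw [hp.pieceIndex_zero, Nat.sub_zero] at h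
  have hcont : Continuous fun b => forward Q r π₀ y S τ 0 ⬝ᵥ b :=
    continuous_const.dotProduct continuous_id
  refine ((hcont.tendsto _).comp h).congr fun K => ?_
  simp only [Function.comp, dotProduct_smul, smul_eq_mul, likelihood_eq_dotProduct, forward,
    obsFlow, flow_self, Matrix.vecMul_one, hP.gridFlow_last hp.nonneg, gridCeil_zero, grid_zero,
    gridStep]

theorem tendsto_posterior (hp : IsJumpPartition T y S τ) (hP : HasGenerator P Q) {t : ℝ}
    (ht : t ∈ Icc 0 T) (i : Fin n)
    (hne : forward Q r π₀ y S τ 0 ⬝ᵥ backward T Q r y S τ 0 ≠ 0) :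
    Tendsto (fun K : ℕ =>
      posterior (P (T / K)) r π₀ K (fun l => y (grid T K l)) (gridCeil T K t) i) atTop
      (𝓝 (forward Q r π₀ y S τ t i * backward T Q r y S τ t i /
        (forward Q r π₀ y S τ 0 ⬝ᵥ backward T Q r y S τ 0))) := by
  have hα := tendsto_pi_nhds.1 (hp.tendsto_vecMul_gridFlow (r := r) (π₀ := π₀) hP ht) i
  have hβ := tendsto_pi_nhds.1 (hp.tendsto_gridFlow_mulVec_one (r := r) hP ht) i
  refine ((hα.mul hβ).div (hp.tendsto_likelihood hP) hne).congr' ?_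
  filter_upwards [hp.eventually_mesh_pow_pos] with K hK
  have hsplit : (T / K) ^ pieceIndex S τ t * (T / K) ^ (S - pieceIndex S τ t) = (T / K) ^ S := by
    rw [← pow_add, Nat.add_sub_cancel' (pieceIndex_le t)]
  rw [Pi.div_apply, Pi.smul_apply, Pi.smul_apply, smul_mul_smul_comm, ← mul_inv, hsplit,
    smul_eq_mul, mul_div_mul_left _ _ (inv_ne_zero hK.ne'),
    posterior_eq_mul_div_likelihood (gridCeil_le ht)]
  rw [hP.gridFlow_last hp.nonneg, gridFlow, gridCeil_zero]
  simp only [grid_zero, gridStep]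

end IsJumpPartition

end PosteriorLimit

section Positivity

theorem sum_pow_changes (m K : ℕ) (h : ℝ) :
    ∑ y : Fin (K + 1) → Fin m, h ^ changes (extendPath y) K = m * (1 + (m - 1) * h) ^ K := by
  set N : Matrix (Fin m) (Fin m) ℝ := .of fun y z => if y = z then 1 else h with hN
  have hweight (y : ℕ → Fin m) : pathWeight 1 (fun _ => N) K y = h ^ changes y K := by
    rw [pathWeight, Pi.one_apply, one_mul, changes, ← Finset.prod_pow_eq_pow_sum]
    refine Finset.prod_congr rfl fun l _ => ?_
    rw [hN, Matrix.of_apply, pow_ite, pow_zero, pow_one]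
  have hsum : N *ᵥ 1 = (1 + (m - 1) * h) • 1 := by
    ext y
    have hcard : 1 ≤ m := y.pos
    simp [hN, Matrix.mulVec, dotProduct, Finset.sum_ite, Finset.filter_eq, Finset.filter_ne,
      Nat.cast_sub hcard]
  simp only [← hweight]
  rw [sum_pathWeight, stepProd_mulVec_eq fun _ => hsum, dotProduct_smul, smul_eq_mul, mul_comm,
    one_dotProduct_one, Fintype.card_fin]

theorem tendsto_sum_pow_changes (m : ℕ) (T : ℝ) :
    Tendsto (fun K : ℕ => ∑ y : Fin (K + 1) → Fin m, (T / K) ^ changes (extendPath y) K) atTop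
      (𝓝 (m * Real.exp ((m - 1) * T))) := by
  simp only [sum_pow_changes, ← mul_div_assoc]
  exact (Real.tendsto_one_add_div_pow_exp _).const_mul _

variable {Ω : Type*} [MeasurableSpace Ω] {μ : Measure Ω} {n m : ℕ} {T : ℝ}
  {Q : Matrix (Fin n) (Fin n) ℝ} {r : Fin n → Fin m → ℝ} {π₀ : Fin n → ℝ} {X : ℝ → Ω → Fin n}
  {Y : ℝ → Ω → Fin m} {P : ℝ → Matrix (Fin n) (Fin n) ℝ}

theorem measureReal_le_of_eventually_mem [IsFiniteMeasure μ] {N : Set Ω} {B : ℕ → Set Ω}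
    (h : ∀ ω ∈ N, ∀ᶠ K in atTop, ω ∈ B K) {b : ℕ → ℝ} {c : ℝ} (hb : ∀ K, μ.real (B K) ≤ b K)
    (hc : Tendsto b atTop (𝓝 c)) : μ.real N ≤ c := by
  set C : ℕ → Set Ω := fun k => ⋂ l ≥ k, B l
  have hmono : Monotone C := fun k l hkl =>
    biInter_subset_biInter_left fun j (hj : l ≤ j) => hkl.trans hj
  have hN : N ⊆ ⋃ k, C k := fun ω hω => by
    obtain ⟨k, hk⟩ := eventually_atTop.1 (h ω hω)
    exact mem_iUnion.2 ⟨k, mem_iInter₂.2 hk⟩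
  have hlim := (ENNReal.tendsto_toReal (measure_ne_top μ _)).comp
    (tendsto_measure_iUnion_atTop (μ := μ) hmono)
  refine (measureReal_mono hN).trans (le_of_tendsto_of_tendsto' hlim hc fun k => ?_)
  exact (measureReal_mono (iInter₂_subset k le_rfl)).trans (hb k)

theorem IsCTHMM.measureReal_likelihood_lt_le [IsFiniteMeasure μ] (h : IsCTHMM μ T Q r π₀ X Y)
    (hM : IsMarkov μ T P X) (hT : 0 ≤ T) {ε : ℝ} (hε : 0 ≤ ε) (K : ℕ) :
    μ.real {ω | likelihood (P (T / K)) r π₀ K (fun l => Y (grid T K l) ω) <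
        ε * (T / K) ^ changes (fun l => Y (grid T K l) ω) K} ≤
      ε * (∑ y : Fin (K + 1) → Fin m, (T / K) ^ changes (extendPath y) K) +
        2 * μ.real (fineSet T X K)ᶜ := by
  set B := {y : Fin (K + 1) → Fin m |
    likelihood (P (T / K)) r π₀ K (extendPath y) < ε * (T / K) ^ changes (extendPath y) K}
  have hpre : {ω | likelihood (P (T / K)) r π₀ K (fun l => Y (grid T K l) ω) <
      ε * (T / K) ^ changes (fun l => Y (grid T K l) ω) K} = gridPath T K Y ⁻¹' B := by
    ext ω
    have hω : ∀ l ≤ K, Y (grid T K l) ω = extendPath (gridPath T K Y ω) l := fun l hl =>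
      (extendPath_gridPath T Y ω hl).symm
    rw [mem_ofPred_eq, likelihood_congr hω, changes_congr hω]
    rfl
  have hint : ∫ ω, B.indicator 1 (gridPath T K Y ω) ∂μ = μ.real (gridPath T K Y ⁻¹' B) :=
    integral_indicator_one (measurable_gridPath hT h.measurable K (.of_discrete (s := B)))
  have hsum : ∑ x : Fin (K + 1) → Fin n, ∑ y,
      jointWeight (P (T / K)) r π₀ K (extendPath x) (extendPath y) * B.indicator 1 y ≤
        ε * ∑ y : Fin (K + 1) → Fin m, (T / K) ^ changes (extendPath y) K := by
    rw [Finset.sum_comm, Finset.mul_sum]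
    refine Finset.sum_le_sum fun y _ => ?_
    rw [← Finset.sum_mul, ← likelihood]
    by_cases hy : y ∈ B
    · simpa only [indicator_of_mem hy, Pi.one_apply, mul_one] using (mem_ofPred_eq ▸ hy).le
    · rw [indicator_of_notMem hy, mul_zero]
      positivity
  have habs := h.abs_integral_sub_sum_le hM hT (K := K) (f := fun _ => B.indicator 1) fun _ y =>
    (norm_indicator_le_norm_self (1 : (Fin (K + 1) → Fin m) → ℝ) y).trans norm_one.le
  rw [hpre, ← hint]
  linarith [(abs_le.1 habs).2]

theorem IsJumpPartition.eventually_likelihood_lt {y : ℝ → Fin m} {S : ℕ} {τ : ℕ → ℝ}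
    (hp : IsJumpPartition T y S τ) (hP : HasGenerator P Q) {ε : ℝ}
    (hε : forward Q r π₀ y S τ 0 ⬝ᵥ backward T Q r y S τ 0 < ε) :
    ∀ᶠ K : ℕ in atTop, likelihood (P (T / K)) r π₀ K (fun l => y (grid T K l)) <
      ε * (T / K) ^ changes (fun l => y (grid T K l)) K := by
  filter_upwards [(hp.tendsto_likelihood hP).eventually_lt_const hε, hp.eventually_changes_eq,
    hp.eventually_mesh_pow_pos] with K hK hS hpos
  rwa [hS, mul_comm, ← inv_mul_lt_iff₀ hpos]

theorem IsCTHMM.ae_forward_dotProduct_backward_pos [IsFiniteMeasure μ]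
    (h : IsCTHMM μ T Q r π₀ X Y) (hT : 0 ≤ T) {S : Ω → ℕ} {τ : Ω → ℕ → ℝ}
    (hp : ∀ ω, IsJumpPartition T (fun t => Y t ω) (S ω) (τ ω)) :
    ∀ᵐ ω ∂μ, 0 < forward Q r π₀ (fun t => Y t ω) (S ω) (τ ω) 0 ⬝ᵥ
      backward T Q r (fun t => Y t ω) (S ω) (τ ω) 0 := by
  obtain ⟨P, hP, hM⟩ := h.hidden.exists_hasGenerator
  set N := {ω | forward Q r π₀ (fun t => Y t ω) (S ω) (τ ω) 0 ⬝ᵥ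
    backward T Q r (fun t => Y t ω) (S ω) (τ ω) 0 ≤ 0}
  have hle (ε : ℝ) (hε : 0 < ε) : μ.real N ≤ ε * (m * Real.exp ((m - 1) * T)) := by
    have hlim := ((tendsto_sum_pow_changes m T).const_mul ε).add
      ((h.hidden.tendsto_measureReal_compl_fineSet hT).const_mul 2)
    rw [mul_zero, add_zero] at hlim
    exact measureReal_le_of_eventually_mem
      (fun ω (hω : _ ≤ _) => (hp ω).eventually_likelihood_lt hP (hω.trans_lt hε))
      (h.measureReal_likelihood_lt_le hM hT hε.le) hlim
  have hzero : μ.real N ≤ 0 := by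
    have hlim : Tendsto (fun ε : ℝ => ε * (m * Real.exp ((m - 1) * T))) (𝓝[>] 0) (𝓝 0) :=
      tendsto_nhdsWithin_of_tendsto_nhds (Continuous.tendsto' (by fun_prop) _ _ (zero_mul _))
    exact ge_of_tendsto hlim (eventually_nhdsWithin_of_forall hle)
  filter_upwards [measure_eq_zero_iff_ae_notMem.1
    ((measureReal_eq_zero_iff).1 (hzero.antisymm measureReal_nonneg))] with ω hω
  exact not_le.1 hω

end Positivity

section ConditionalExpectation

variable {Ω : Type*} {m₀ mΩ : MeasurableSpace Ω} {μ : Measure Ω} {f g : Ω → ℝ}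

theorem setIntegral_eq_zero_of_isPiSystem (hm : m₀ ≤ mΩ) {C : Set (Set Ω)}
    (hgen : m₀ = MeasurableSpace.generateFrom C) (hC : IsPiSystem C) (hf : Integrable f μ)
    (huniv : ∫ ω, f ω ∂μ = 0) (h : ∀ A ∈ C, ∫ ω in A, f ω ∂μ = 0) {A : Set Ω}
    (hA : MeasurableSet[m₀] A) : ∫ ω in A, f ω ∂μ = 0 := by
  induction A, hA using MeasurableSpace.induction_on_inter hgen hC with
  | empty => exact setIntegral_empty
  | basic A hA => exact h A hA
  | compl A hA ih => rw [setIntegral_compl (hm A hA) hf, huniv, ih, sub_zero]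
  | iUnion B hdisj hB ih =>
    rw [integral_iUnion (fun k => hm _ (hB k)) hdisj hf.integrableOn]
    simp only [ih, tsum_zero]

theorem ae_eq_condExp_of_isPiSystem [IsFiniteMeasure μ] (hm : m₀ ≤ mΩ) {C : Set (Set Ω)}
    (hgen : m₀ = MeasurableSpace.generateFrom C) (hC : IsPiSystem C) (hf : Integrable f μ)
    (hg : Integrable g μ) (hgm : AEStronglyMeasurable[m₀] g μ)
    (huniv : ∫ ω, (f ω - g ω) ∂μ = 0) (h : ∀ A ∈ C, ∫ ω in A, (f ω - g ω) ∂μ = 0) :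
    g =ᵐ[μ] μ[f|m₀] := by
  refine ae_eq_condExp_of_forall_setIntegral_eq hm hf (fun _ _ _ => hg.integrableOn)
    (fun A hA _ => ?_) hgm
  have hzero : ∫ ω in A, (f ω - g ω) ∂μ = 0 :=
    setIntegral_eq_zero_of_isPiSystem hm hgen hC (hf.sub hg) huniv h hA
  rw [integral_sub hf.integrableOn hg.integrableOn] at hzero
  exact (sub_eq_zero.1 hzero).symm

theorem tendsto_setIntegral_of_eventually_mem_iff [IsFiniteMeasure μ] {A : ℕ → Set Ω}
    {B : Set Ω} {F : ℕ → Ω → ℝ} {c : ℝ} (hA : ∀ K, MeasurableSet (A K)) (hB : MeasurableSet B)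
    (hF : ∀ K, AEStronglyMeasurable (F K) μ) (hc : ∀ K ω, ‖F K ω‖ ≤ c)
    (hAB : ∀ ω, ∀ᶠ K in atTop, ω ∈ A K ↔ ω ∈ B)
    (hlim : ∀ᵐ ω ∂μ, Tendsto (fun K => F K ω) atTop (𝓝 (f ω))) :
    Tendsto (fun K => ∫ ω in A K, F K ω ∂μ) atTop (𝓝 (∫ ω in B, f ω ∂μ)) := by
  simp only [← integral_indicator (hA _), ← integral_indicator hB]
  refine tendsto_integral_of_dominated_convergence (fun _ => c)
    (fun K => (hF K).indicator (hA K)) (integrable_const c)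
    (fun K => .of_forall fun ω => (norm_indicator_le_norm_self _ _).trans (hc K ω)) ?_
  filter_upwards [hlim] with ω hω
  by_cases hωB : ω ∈ B
  · rw [indicator_of_mem hωB]
    refine hω.congr' ?_
    filter_upwards [hAB ω] with K hK
    rw [indicator_of_mem (hK.2 hωB)]
  · rw [indicator_of_notMem hωB]
    refine tendsto_const_nhds.congr' ?_
    filter_upwards [hAB ω] with K hK
    rw [indicator_of_notMem (mt hK.1 hωB)]

theorem exists_eq_biInter_preimage_of_mem_piiUnionInter {ι E : Type*} {Y : ι → Ω → E}
    {I : Set ι} {A : Set Ω}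
    (hA : A ∈ piiUnionInter (fun u => {s | MeasurableSet[.comap (Y u) ⊤] s}) I) :
    ∃ (F : Finset ι) (B : ι → Set E), ↑F ⊆ I ∧ A = ⋂ u ∈ F, Y u ⁻¹' B u := by
  obtain ⟨F, hF, A', hA', rfl⟩ := hA
  choose! B _ hB using hA'
  exact ⟨F, B, hF, iInter₂_congr fun u hu => (hB u hu).symm⟩

end ConditionalExpectation

section Filtering

variable {Ω : Type*} {n m : ℕ} {T t : ℝ} {r : Fin n → Fin m → ℝ} {π₀ : Fin n → ℝ}
  {Y : ℝ → Ω → Fin m} {K k : ℕ}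

theorem posterior_extendPath_gridPath (P : Matrix (Fin n) (Fin n) ℝ) (k : ℕ) (i : Fin n)
    (ω : Ω) :
    posterior P r π₀ K (extendPath (gridPath T K Y ω)) k i =
      posterior P r π₀ K (fun l => Y (grid T K l) ω) k i :=
  posterior_congr (fun _ hl => extendPath_gridPath T Y ω hl) k i

theorem measurable_posterior (hT : 0 ≤ T) (P : Matrix (Fin n) (Fin n) ℝ) (K k : ℕ) (i : Fin n) :
    Measurable[pathSigma Y T] fun ω => posterior P r π₀ K (fun l => Y (grid T K l) ω) k i := by
  simp only [← posterior_extendPath_gridPath]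
  exact (measurable_of_finite fun y => posterior P r π₀ K (extendPath y) k i).comp
    (@measurable_gridPath _ _ _ (pathSigma Y T) _ hT (fun _ hu => measurable_pathSigma hu) K)

theorem biInter_preimage_grid_eq {F : Finset ℝ} (hF : ↑F ⊆ Icc 0 T) (B : ℝ → Set (Fin m))
    (K : ℕ) : ⋂ u ∈ F, Y (grid T K (gridCeil T K u)) ⁻¹' B u =
      gridPath T K Y ⁻¹' {y | ∀ u ∈ F, extendPath y (gridCeil T K u) ∈ B u} := by
  ext ω
  simp only [mem_iInter, mem_preimage, mem_ofPred_eq]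
  exact forall₂_congr fun u hu => by rw [extendPath_gridPath T Y ω (gridCeil_le (hF hu))]

variable [MeasurableSpace Ω] {μ : Measure Ω} {Q : Matrix (Fin n) (Fin n) ℝ}
  {X : ℝ → Ω → Fin n} {P : ℝ → Matrix (Fin n) (Fin n) ℝ}

namespace IsCTHMM

theorem exists_isJumpPartition (h : IsCTHMM μ T Q r π₀ X Y) (ω : Ω) :
    ∃ S τ, IsJumpPartition T (fun t => Y t ω) S τ := by
  obtain ⟨S, τ, hp⟩ := h.hidden.path ω
  exact CTHMM.exists_isJumpPartition hp.zero hp.lt hp.le (h.held ω S τ hp)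

theorem init_nonneg (h : IsCTHMM μ T Q r π₀ X Y) (i : Fin n) : 0 ≤ π₀ i :=
  h.hidden.init i ▸ measureReal_nonneg

theorem posterior_mem_Icc (h : IsCTHMM μ T Q r π₀ X Y) (hT : 0 ≤ T) (hP : HasGenerator P Q)
    (y : ℕ → Fin m) (k : ℕ) (i : Fin n) : posterior (P (T / K)) r π₀ K y k i ∈ Icc 0 1 :=
  CTHMM.posterior_mem_Icc (hP.apply_nonneg (by positivity)) (fun i => (h.emission i).1)
    h.init_nonneg y k i

theorem abs_indicator_sub_posterior_le (h : IsCTHMM μ T Q r π₀ X Y) (hT : 0 ≤ T)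
    (hP : HasGenerator P Q) (y : ℕ → Fin m) (k : ℕ) (i j : Fin n) :
    |(if j = i then 1 else 0) - posterior (P (T / K)) r π₀ K y k i| ≤ 1 := by
  obtain ⟨h₀, h₁⟩ := h.posterior_mem_Icc hT hP (K := K) y k i
  rw [abs_le]
  split_ifs <;> constructor <;> linarith

theorem abs_setIntegral_indicator_sub_posterior_le [IsFiniteMeasure μ]
    (h : IsCTHMM μ T Q r π₀ X Y) (hT : 0 ≤ T) (hP : HasGenerator P Q) (hM : IsMarkov μ T P X)
    (B : Set (Fin (K + 1) → Fin m)) (hk : k ≤ K) (i : Fin n) :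
    |∫ ω in gridPath T K Y ⁻¹' B, ((if X (grid T K k) ω = i then 1 else 0) -
        posterior (P (T / K)) r π₀ K (fun l => Y (grid T K l) ω) k i) ∂μ| ≤
      2 * μ.real (fineSet T X K)ᶜ := by
  set e := fun (x : Fin (K + 1) → Fin n) (y : Fin (K + 1) → Fin m) =>
    (if extendPath x k = i then 1 else 0) - posterior (P (T / K)) r π₀ K (extendPath y) k i
  have hbound (x y) : |B.indicator (e x) y| ≤ 1 :=
    (norm_indicator_le_norm_self (e x) y).trans (h.abs_indicator_sub_posterior_le hT hP _ _ _ _)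
  have hsum : ∑ x, ∑ y, jointWeight (P (T / K)) r π₀ K (extendPath x) (extendPath y) *
      B.indicator (e x) y = 0 := by
    rw [Finset.sum_comm]
    refine Finset.sum_eq_zero fun y _ => ?_
    by_cases hy : y ∈ B
    · simp only [indicator_of_mem hy]
      exact sum_jointWeight_mul_indicator_sub_posterior (hP.apply_nonneg (by positivity))
        (fun i => (h.emission i).1) h.init_nonneg _ k i
    · simp only [indicator_of_notMem hy, mul_zero, Finset.sum_const_zero]
  have hint : ∫ ω in gridPath T K Y ⁻¹' B, ((if X (grid T K k) ω = i then 1 else 0) -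
      posterior (P (T / K)) r π₀ K (fun l => Y (grid T K l) ω) k i) ∂μ =
        ∫ ω, B.indicator (e (gridPath T K X ω)) (gridPath T K Y ω) ∂μ := by
    rw [← integral_indicator (measurable_gridPath hT h.measurable K (.of_discrete (s := B)))]
    refine integral_congr_ae (.of_forall fun ω => ?_)
    simp only [indicator, mem_preimage, e, extendPath_gridPath T X ω hk,
      posterior_extendPath_gridPath]
    rfl
  have hle := h.abs_integral_sub_sum_le hM hT hbound
  rwa [hsum, sub_zero, ← hint] at hle

theorem eventually_mem_biInter_preimage_grid_iff (h : IsCTHMM μ T Q r π₀ X Y) {F : Finset ℝ}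
    (hF : ↑F ⊆ Icc 0 T) (B : ℝ → Set (Fin m)) (ω : Ω) :
    ∀ᶠ K in atTop, ω ∈ ⋂ u ∈ F, Y (grid T K (gridCeil T K u)) ⁻¹' B u ↔
      ω ∈ ⋂ u ∈ F, Y u ⁻¹' B u := by
  obtain ⟨S, τ, hp⟩ := h.exists_isJumpPartition ω
  filter_upwards [(Filter.eventually_all_finset F).2 fun u hu =>
    hp.eventually_grid_gridCeil (hF hu)] with K hK
  simp only [mem_iInter, mem_preimage]
  exact forall₂_congr fun u hu => by rw [hK u hu]

theorem setIntegral_biInter_preimage_indicator_sub_eq_zero [IsFiniteMeasure μ]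
    (h : IsCTHMM μ T Q r π₀ X Y) (hP : HasGenerator P Q) (hM : IsMarkov μ T P X)
    (ht : t ∈ Icc 0 T) (i : Fin n) {g : Ω → ℝ}
    (hg : ∀ᵐ ω ∂μ, Tendsto (fun K : ℕ => posterior (P (T / K)) r π₀ K
      (fun l => Y (grid T K l) ω) (gridCeil T K t) i) atTop (𝓝 (g ω)))
    {F : Finset ℝ} (hF : ↑F ⊆ Icc 0 T) (B : ℝ → Set (Fin m)) :
    ∫ ω in ⋂ u ∈ F, Y u ⁻¹' B u, ((if X t ω = i then 1 else 0) - g ω) ∂μ = 0 := by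
  have hT : 0 ≤ T := ht.1.trans ht.2
  have hX (K : ℕ) : Measurable fun ω =>
      if X (grid T K (gridCeil T K t)) ω = i then (1 : ℝ) else 0 :=
    .ite (h.hidden.measurable _ (grid_gridCeil_mem ht) (measurableSet_singleton i))
      measurable_const measurable_const
  have hlim := tendsto_setIntegral_of_eventually_mem_iff (μ := μ)
    (F := fun K ω => (if X (grid T K (gridCeil T K t)) ω = i then 1 else 0) -
      posterior (P (T / K)) r π₀ K (fun l => Y (grid T K l) ω) (gridCeil T K t) i)
    (f := fun ω => (if X t ω = i then 1 else 0) - g ω)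
    (fun K => Finset.measurableSet_biInter F fun u hu =>
      h.measurable _ (grid_gridCeil_mem (hF hu)) (.of_discrete (s := B u)))
    (Finset.measurableSet_biInter F fun u hu => h.measurable u (hF hu) (.of_discrete (s := B u)))
    (fun K => ((hX K).sub ((measurable_posterior hT _ K _ i).mono
      (pathSigma_le h.measurable) le_rfl)).aestronglyMeasurable)
    (fun K ω => h.abs_indicator_sub_posterior_le hT hP _ _ _ _)
    (h.eventually_mem_biInter_preimage_grid_iff hF B) ?_
  · refine tendsto_nhds_unique hlim (squeeze_zero_norm (fun K => ?_)
      (by simpa using (h.hidden.tendsto_measureReal_compl_fineSet hT).const_mul 2))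
    rw [biInter_preimage_grid_eq hF]
    exact h.abs_setIntegral_indicator_sub_posterior_le hT hP hM _ (gridCeil_le ht) i
  · filter_upwards [hg] with ω hω
    obtain ⟨S, τ, hp⟩ := h.hidden.path ω
    refine Tendsto.sub (tendsto_const_nhds.congr' ?_) hω
    filter_upwards [hp.eventually_grid_gridCeil ht] with K hK
    rw [hK]

theorem condProb_ae_eq_of_tendsto_posterior [IsFiniteMeasure μ] (h : IsCTHMM μ T Q r π₀ X Y)
    (hP : HasGenerator P Q) (hM : IsMarkov μ T P X) (ht : t ∈ Icc 0 T) (i : Fin n) {g : Ω → ℝ}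
    (hg : ∀ᵐ ω ∂μ, Tendsto (fun K : ℕ => posterior (P (T / K)) r π₀ K
      (fun l => Y (grid T K l) ω) (gridCeil T K t) i) atTop (𝓝 (g ω))) :
    μ⟦{ω | X t ω = i} | pathSigma Y T⟧ =ᵐ[μ] g := by
  have hT : 0 ≤ T := ht.1.trans ht.2
  have hm := pathSigma_le h.measurable
  have hgm : AEStronglyMeasurable[pathSigma Y T] g μ :=
    ⟨_, (Measurable.limsup fun K =>
      measurable_posterior hT (P (T / K)) K (gridCeil T K t) i).stronglyMeasurable,
      hg.mono fun ω hω => hω.limsup_eq.symm⟩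
  have hgle : ∀ᵐ ω ∂μ, ‖g ω‖ ≤ 1 := by
    filter_upwards [hg] with ω hω
    have hmem := isClosed_Icc.mem_of_tendsto hω
      (.of_forall fun K => h.posterior_mem_Icc hT hP _ _ _)
    exact (Real.norm_of_nonneg hmem.1).trans_le hmem.2
  have hXm : MeasurableSet {ω | X t ω = i} := h.hidden.measurable t ht (measurableSet_singleton i)
  have hzero {F : Finset ℝ} (hF : ↑F ⊆ Icc 0 T) (B : ℝ → Set (Fin m)) :
      ∫ ω in ⋂ u ∈ F, Y u ⁻¹' B u, ({ω | X t ω = i}.indicator (fun _ => 1) ω - g ω) ∂μ = 0 := by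
    simpa only [indicator_apply, mem_ofPred_eq] using
      h.setIntegral_biInter_preimage_indicator_sub_eq_zero hP hM ht i hg hF B
  refine (ae_eq_condExp_of_isPiSystem hm
    (generateFrom_piiUnionInter_measurableSet (fun u => .comap (Y u) ⊤) (Icc 0 T)).symm
    (isPiSystem_piiUnionInter _ (fun u => @MeasurableSpace.isPiSystem_measurableSet _
      (.comap (Y u) ⊤)) _)
    ((integrable_const 1).indicator hXm)
    (.of_bound (hgm.mono hm) 1 hgle) hgm ?_ fun A hA => ?_).symm
  · simpa using hzero (F := ∅) (by simp) fun _ => univ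
  · obtain ⟨F, B, hF, rfl⟩ := exists_eq_biInter_preimage_of_mem_piiUnionInter hA
    exact hzero hF B

theorem condProb_ae_eq_forward_mul_backward_div [IsFiniteMeasure μ]
    (h : IsCTHMM μ T Q r π₀ X Y) {S : Ω → ℕ} {τ : Ω → ℕ → ℝ}
    (hp : ∀ ω, IsJumpPartition T (fun t => Y t ω) (S ω) (τ ω)) (ht : t ∈ Icc 0 T) (i : Fin n) :
    μ⟦{ω | X t ω = i} | pathSigma Y T⟧ =ᵐ[μ] fun ω =>
      forward Q r π₀ (fun t => Y t ω) (S ω) (τ ω) t i *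
          backward T Q r (fun t => Y t ω) (S ω) (τ ω) t i /
        (forward Q r π₀ (fun t => Y t ω) (S ω) (τ ω) 0 ⬝ᵥ
          backward T Q r (fun t => Y t ω) (S ω) (τ ω) 0) := by
  obtain ⟨P, hP, hM⟩ := h.hidden.exists_hasGenerator
  refine h.condProb_ae_eq_of_tendsto_posterior hP hM ht i ?_
  filter_upwards [h.ae_forward_dotProduct_backward_pos (ht.1.trans ht.2) hp] with ω hω
  exact (hp ω).tendsto_posterior hP ht i hω.ne'

end IsCTHMM

end Filtering

end

end CTHMM

theorem theorem1 {Ω : Type*} [MeasurableSpace Ω] (μ : Measure Ω) [IsProbabilityMeasure μ]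
    {n m : ℕ} (T : ℝ) (hT : 0 ≤ T) (Q : Matrix (Fin n) (Fin n) ℝ) (r : Fin n → Fin m → ℝ)
    (π₀ : Fin n → ℝ) (X : ℝ → Ω → Fin n) (Y : ℝ → Ω → Fin m)
    (hXY : IsCTHMM μ T Q r π₀ X Y) :
    -- every observed path is a step function
    (∀ ω, ∃ S τ, IsJumpPartition T (fun t => Y t ω) S τ) ∧
    -- along any step path both piecewise ODEs have exactly one solution on `[0, T]`
    (∀ (y : ℝ → Fin m) (S : ℕ) (τ : ℕ → ℝ), IsJumpPartition T y S τ →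
      (∃ α, IsForwardSolution T Q r π₀ y S τ α ∧
        ∀ α', IsForwardSolution T Q r π₀ y S τ α' → EqOn α' α (Icc 0 T)) ∧
      (∃ β, IsBackwardSolution T Q r y S τ β ∧
        ∀ β', IsBackwardSolution T Q r y S τ β' → EqOn β' β (Icc 0 T)) ∧
      -- the inner product of the two solutions is constant in time
      (∀ α β, IsForwardSolution T Q r π₀ y S τ α → IsBackwardSolution T Q r y S τ β →
        ∀ t ∈ Icc 0 T, α t ⬝ᵥ β t = α 0 ⬝ᵥ β 0)) ∧
    -- the posterior distribution, with the solutions taken along the observed path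
    (∀ (S : Ω → ℕ) (τ : Ω → ℕ → ℝ) (α β : Ω → ℝ → Fin n → ℝ),
      (∀ ω, IsJumpPartition T (fun t => Y t ω) (S ω) (τ ω)) →
      (∀ ω, IsForwardSolution T Q r π₀ (fun t => Y t ω) (S ω) (τ ω) (α ω)) →
      (∀ ω, IsBackwardSolution T Q r (fun t => Y t ω) (S ω) (τ ω) (β ω)) →
      (∀ᵐ ω ∂μ, 0 < α ω 0 ⬝ᵥ β ω 0) ∧
      ∀ t ∈ Icc 0 T, ∀ i : Fin n,
        μ⟦{ω | X t ω = i} | pathSigma Y T⟧ =ᵐ[μ]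
          fun ω => α ω t i * β ω t i / (α ω 0 ⬝ᵥ β ω 0)) := by
  refine ⟨hXY.exists_isJumpPartition, fun y S τ hp => ⟨?_, ?_, fun α β hα hβ t ht => ?_⟩,
    fun S τ α β hp hα hβ => ?_⟩
  · exact ⟨_, hp.isForwardSolution_forward, fun _ => hp.eqOn_forward⟩
  · exact ⟨_, hp.isBackwardSolution_backward, fun _ => hp.eqOn_backward⟩
  · have h₀ : (0 : ℝ) ∈ Icc 0 T := ⟨le_rfl, hT⟩
    rw [hp.eqOn_forward hα ht, hp.eqOn_backward hβ ht, hp.eqOn_forward hα h₀,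
      hp.eqOn_backward hβ h₀, hp.forward_dotProduct_backward ht]
  · have hα_eq ω := (hp ω).eqOn_forward (hα ω)
    have hβ_eq ω := (hp ω).eqOn_backward (hβ ω)
    have h₀ : (0 : ℝ) ∈ Icc 0 T := ⟨le_rfl, hT⟩
    simp only [hα_eq _ h₀, hβ_eq _ h₀]
    refine ⟨hXY.ae_forward_dotProduct_backward_pos hT hp, fun t ht i => ?_⟩
    simp only [hα_eq _ ht, hβ_eq _ ht]
    exact hXY.condProb_ae_eq_forward_mul_backward_div hp ht i
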